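/- **Problem.** Let $m,n,d,k$ be natural numbers, $x^l_i,y_j\in\mathbb R^d$ ($l\in[m]$, $i,j\in[n]$), $p^1,\dots,p^m\in\Delta^n$ and $\omega\in\Delta^m$ probability vectors with positive entries. Put $\mathcal M=\mathrm{St}(d,k)=\{U\in\mathbb R^{d\times k}:U^\top U=I_k\}$, $f(\pi,U)=\sum_l\omega^l\sum_{i,j}\pi^l_{ij}\|U^\top(x^l_i-y_j)\|^2$, and let $\Pi(p)$ be the set of $\pi=(\pi^l)_{l\in[m]}$, $\pi^l\in\mathbb R^{n\times n}_+$, with $\pi^l\mathbf 1=p^l$ and $(\pi^l)^\top\mathbf 1$ independent of $l$. The fixed-support RPRWB problem is $\max_{U\in\mathcal M}\min_{\pi\in\Pi(p)}f(\pi,U)$. A pair $(\hat\pi,\hat U)\in\Pi(p)\times\mathcal M$ is an $\epsilon$-stationary point of it if $\|\mathrm{grad}_Uf(\hat\pi,\hat U)\|_F\le\epsilon$ and $f(\hat\pi,\hat U)-\min_{\pi\in\Pi(p)}f(\pi,\hat U)\le\epsilon$. Here $\mathrm{grad}_U$ is the Riemannian gradient, the orthogonal projection of the Euclidean gradient onto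 $T_U\mathcal M=\{\xi: U^\top\xi+\xi^\top U=0\}$. Let $\bar c=\max_{l,i,j}\|x^l_i-y_j\|^2$, assumed positive, and $\underline\omega=\min_l\omega^l$. **Retraction.** Let $\mathrm{Retr}$ be a retraction on $\mathcal M$: a smooth map $T\mathcal M\to\mathcal M$ with $\mathrm{Retr}_U(0)=U$ and $\|\mathrm{Retr}_U(\xi)-(U+\xi)\|_F/\|\xi\|_F\to0$ as $T_U\mathcal M\ni\xi\to0$. Let $L_1,L_2>0$ be constants with $\|\mathrm{Retr}_U(\xi)-U\|_F\le L_1\|\xi\|_F$ and $\|\mathrm{Retr}_U(\xi)-(U+\xi)\|_F\le L_2\|\xi\|_F^2$ for all $U\in\mathcal M$, $\xi\in T_U\mathcal M$. (Such constants exist for every retraction; this is part of the claim.) **Algorithm (RBCD).** Given $\epsilon>0$, set $$\eta=\frac{\epsilon}{4\log n+2},\qquad \rho=\frac{2\bar c}{\eta}+\frac{4\bar c^2}{\eta^2},\qquad \tau=\frac1{4L_2\bar c/\eta+\rho L_1^2}.$$ Let $\zeta(u^l,v^l,U)_{ij}=\exp(-\|U^\top(x^l_i-y_j)\|^2/\eta+u^l_i+v^l_j)$,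 let $\pi(u^l,v^l,U)$ be $\zeta(u^l,v^l,U)$ divided by the sum of its entries, and let $g(u,v,U)=\sum_l\omega^l\{\log\sum_{ij}\zeta(u^l,v^l,U)_{ij}-\langle u^l,p^l\rangle\}$. Start from any $U_0\in\mathcal M$ and $u_0,v_0\in\mathbb R^{m\times n}$ with $\sum_l\omega^lv_0^l=0$. For $t=0,1,2,\dots$ let (logarithms, exponentials and quotients of vectors entrywise) $$u^l_{t+1}=u^l_t+\log\frac{p^l}{\zeta(u^l_t,v^l_t,U_t)\mathbf 1},\qquad q^l_t=\zeta(u^l_{t+1},v^l_t,U_t)^\top\mathbf 1,\qquad q_{t+1}=\exp\Big(\sum_l\omega^l\log q^l_t\Big),$$ $$v^l_{t+1}=v^l_t+\log\frac{q_{t+1}}{q^l_t},\qquad U_{t+1}=\mathrm{Retr}_{U_t}\big(-\tau\,\mathrm{grad}_Ug(u_{t+1},v_{t+1},U_t)\big),\qquad \bar q_t=\sum_l\omega^lq^l_t,$$ and break as soon as $$\sum_l\omega^l\|q^l_t-\bar q_t\|_1\le\frac{\underline\omega^{3/2}\epsilon}{12\bar c}\quad\text{and}\quad\eta\,\|\mathrm{grad}_Ug(u_{t+1},v_{t+1},U_t)\|_F\le\frac{\epsilon}{3}.$$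 If the break occurs at $t=T$, return $\hat U=U_T$ and $\hat\pi^l=\mathrm{Round}(\pi(u^l_{T+1},v^l_T,U_T),p^l,\bar q_T)$. Here $\mathrm{Round}(\pi,p,q)$ is computed as follows: multiply row $i$ of $\pi$ by $\min(p_i/[\pi\mathbf 1]_i,1)$ to get $\pi'$; multiply column $j$ of $\pi'$ by $\min(q_j/[\pi'^\top\mathbf 1]_j,1)$ to get $\pi''$; with $\mathrm{err}_p=p-\pi''\mathbf 1$ and $\mathrm{err}_q=q-\pi''^\top\mathbf 1$ return $\pi''+\mathrm{err}_p\mathrm{err}_q^\top/\|\mathrm{err}_p\|_1$ (and $\pi''$ if $\mathrm{err}_p=0$). **Theorem.** The algorithm stops after finitely many iterations, and the returned $(\hat\pi,\hat U)$ is an $\epsilon$-stationary point of the fixed-support RPRWB problem. The number of iterations is $$T+1=O\big(L_1^2\,\bar c^5\log(n)\,\underline\omega^{-3}\epsilon^{-3}\big)$$ in the following sense: for every $\kappa>0$ there is a number $K(\kappa)$ depending on $\kappa$ only, such that $$T+1\le K(\kappa)\,L_1^2\,\bar c^5\log(n)\,\underline\omega^{-3}\epsilon^{-3}$$ for all problems,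 retractions, constants $L_1,L_2$, accuracies $\epsilon>0$ and initial points as above with $n\ge2$, $L_1\ge\kappa$, $\bar c\ge\kappa$, $\kappa\epsilon\le\bar c$ and $\kappa L_2\epsilon\le L_1^2\bar c$. -/

import Mathlib

open Set Filter Topology Matrix
open scoped ContDiff

-- Matrices carry the Frobenius norm.
attribute [local instance] Matrix.frobeniusNormedAddCommGroup Matrix.frobeniusNormedSpace

noncomputable section

namespace RPRWB

/-! ### The Stiefel manifold, Riemannian gradients, retractions -/

/-- The Stiefel manifold `St(d, k)`. -/
def stiefel (d k : ℕ) : Set (Matrix (Fin d) (Fin k) ℝ) := {U | Uᵀ * U = 1}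

/-- The tangent space of `St(d, k)` at `U`. -/
def tangentSpace {d k : ℕ} (U : Matrix (Fin d) (Fin k) ℝ) : Set (Matrix (Fin d) (Fin k) ℝ) :=
  {ξ | Uᵀ * ξ + ξᵀ * U = 0}

/-- The tangent bundle of `St(d, k)`, inside pairs of matrices. -/
def tangentBundle (d k : ℕ) : Set (Matrix (Fin d) (Fin k) ℝ × Matrix (Fin d) (Fin k) ℝ) :=
  {z | z.1 ∈ stiefel d k ∧ z.2 ∈ tangentSpace z.1}

/-- The orthogonal projection onto the tangent space at `U ∈ St(d, k)`,
`G ↦ G - U (Uᵀ G + Gᵀ U) / 2`; see the next two lemmas. -/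
def tangentProj {d k : ℕ} (U G : Matrix (Fin d) (Fin k) ℝ) : Matrix (Fin d) (Fin k) ℝ :=
  G - (1 / 2 : ℝ) • (U * (Uᵀ * G + Gᵀ * U))

theorem tangentProj_mem {d k : ℕ} {U : Matrix (Fin d) (Fin k) ℝ} (hU : U ∈ stiefel d k)
    (G : Matrix (Fin d) (Fin k) ℝ) : tangentProj U G ∈ tangentSpace U := by
  have h : Uᵀ * U = 1 := hU
  simp only [tangentSpace, tangentProj, Set.mem_ofPred_eq, Matrix.mul_sub, Matrix.transpose_sub,
    Matrix.sub_mul, Matrix.transpose_smul, Matrix.transpose_mul, Matrix.transpose_add,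
    Matrix.transpose_transpose, Matrix.mul_smul, Matrix.smul_mul]
  rw [← Matrix.mul_assoc, h, Matrix.one_mul, Matrix.mul_assoc, h, Matrix.mul_one]
  module

theorem tangentProj_residual_orthogonal {d k : ℕ} {U : Matrix (Fin d) (Fin k) ℝ}
    (G : Matrix (Fin d) (Fin k) ℝ) {ξ : Matrix (Fin d) (Fin k) ℝ} (hξ : ξ ∈ tangentSpace U) :
    ((G - tangentProj U G)ᵀ * ξ).trace = 0 := by
  have h : ξᵀ * U = -(Uᵀ * ξ) := eq_neg_of_add_eq_zero_right hξ
  set S := Uᵀ * G + Gᵀ * U with hS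
  have hSt : Sᵀ = S := by
    simp [hS, Matrix.transpose_add, Matrix.transpose_mul, add_comm]
  have key : (S * (Uᵀ * ξ)).trace = -(S * (Uᵀ * ξ)).trace := by
    conv_lhs => rw [← Matrix.trace_transpose, Matrix.transpose_mul, Matrix.transpose_mul,
      Matrix.transpose_transpose, hSt, h, Matrix.neg_mul, Matrix.trace_neg, Matrix.trace_mul_comm]
  have hz : (S * (Uᵀ * ξ)).trace = 0 := by linarith
  have e : (G - tangentProj U G)ᵀ * ξ = (1 / 2 : ℝ) • (S * (Uᵀ * ξ)) := by
    simp only [tangentProj, sub_sub_cancel, Matrix.transpose_smul, Matrix.transpose_mul,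
      Matrix.smul_mul, Matrix.mul_assoc]
    rw [← hS, hSt]
  rw [e, Matrix.trace_smul, hz, smul_zero]

/-- The Euclidean gradient of a function of a matrix: the matrix of its partial derivatives. -/
def euclideanGrad {d k : ℕ} (F : Matrix (Fin d) (Fin k) ℝ → ℝ) (U : Matrix (Fin d) (Fin k) ℝ) :
    Matrix (Fin d) (Fin k) ℝ :=
  Matrix.of fun a b => deriv (fun s : ℝ => F (U + s • Matrix.single a b (1 : ℝ))) 0

/-- The Riemannian gradient on `St(d, k)`: the tangential part of the Euclidean gradient. -/
def riemannianGrad {d k : ℕ} (F : Matrix (Fin d) (Fin k) ℝ → ℝ) (U : Matrix (Fin d) (Fin k) ℝ) :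
    Matrix (Fin d) (Fin k) ℝ :=
  tangentProj U (euclideanGrad F U)

/-- `R U ξ` is `Retr_U(ξ)`; only its values on the tangent bundle matter. -/
structure IsRetraction {d k : ℕ}
    (R : Matrix (Fin d) (Fin k) ℝ → Matrix (Fin d) (Fin k) ℝ → Matrix (Fin d) (Fin k) ℝ) :
    Prop where
  mapsTo : ∀ U ∈ stiefel d k, ∀ ξ ∈ tangentSpace U, R U ξ ∈ stiefel d k
  smooth : ContDiffOn ℝ ∞ (Function.uncurry R) (tangentBundle d k)
  zero : ∀ U ∈ stiefel d k, R U 0 = U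
  first_order : ∀ U ∈ stiefel d k,
    Tendsto (fun ξ => ‖R U ξ - (U + ξ)‖ / ‖ξ‖) (𝓝[tangentSpace U \ {0}] 0) (𝓝 0)

/-- `L₁` and `L₂` are first and second order constants of the retraction `R`. -/
structure IsRetractionConst {d k : ℕ}
    (R : Matrix (Fin d) (Fin k) ℝ → Matrix (Fin d) (Fin k) ℝ → Matrix (Fin d) (Fin k) ℝ)
    (L₁ L₂ : ℝ) : Prop where
  pos₁ : 0 < L₁
  pos₂ : 0 < L₂
  bound₁ : ∀ U ∈ stiefel d k, ∀ ξ ∈ tangentSpace U, ‖R U ξ - U‖ ≤ L₁ * ‖ξ‖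
  bound₂ : ∀ U ∈ stiefel d k, ∀ ξ ∈ tangentSpace U, ‖R U ξ - (U + ξ)‖ ≤ L₂ * ‖ξ‖ ^ 2

/-! ### The fixed-support RPRWB problem -/

/-- The data of a problem: support points `X l i` of the measure `μ^l` with weights `p l i`,
support points `Y j` of the barycenter, and barycentric weights `w l`. -/
structure Data (m n d : ℕ) where
  X : Fin m → Fin n → Fin d → ℝ
  Y : Fin n → Fin d → ℝ
  p : Fin m → Fin n → ℝ
  w : Fin m → ℝ

/-- The squared Euclidean norm. -/
def sqNorm {q : ℕ} (z : Fin q → ℝ) : ℝ := ∑ a, z a ^ 2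

/-- The `ℓ₁` norm. -/
def l1Norm {q : ℕ} (z : Fin q → ℝ) : ℝ := ∑ a, |z a|

variable {m n d k : ℕ}

/-- The weights `w` and `p^l` are probability vectors with positive entries. -/
structure Data.Valid (P : Data m n d) : Prop where
  w_pos : ∀ l, 0 < P.w l
  w_sum : ∑ l, P.w l = 1
  p_pos : ∀ l i, 0 < P.p l i
  p_sum : ∀ l, ∑ i, P.p l i = 1

/-- The cost matrices `C^l`. -/
def Data.cost (P : Data m n d) (l : Fin m) (i j : Fin n) : ℝ := sqNorm (P.X l i - P.Y j)

/-- The projected cost `‖Uᵀ (x^l_i - y_j)‖²`. -/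
def Data.projCost (P : Data m n d) (U : Matrix (Fin d) (Fin k) ℝ) (l : Fin m) (i j : Fin n) : ℝ :=
  sqNorm (Uᵀ *ᵥ (P.X l i - P.Y j))

/-- `max_l ‖C^l‖_∞`, with the entrywise maximum norm. -/
def Data.cbar (P : Data m n d) : ℝ := ⨆ z : Fin m × Fin n × Fin n, P.cost z.1 z.2.1 z.2.2

/-- `min_l w l`. -/
def Data.wmin (P : Data m n d) : ℝ := ⨅ l, P.w l

/-- The objective function `f(π, U)`. -/
def Data.f (P : Data m n d) (π : Fin m → Matrix (Fin n) (Fin n) ℝ)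
    (U : Matrix (Fin d) (Fin k) ℝ) : ℝ :=
  ∑ l, P.w l * ∑ i, ∑ j, π l i j * P.projCost U l i j

/-- The feasible set `Π(p)`: nonnegative matrices with row sums `p^l` and a common vector of
column sums. -/
def Data.couplings (P : Data m n d) : Set (Fin m → Matrix (Fin n) (Fin n) ℝ) :=
  {π | (∀ l i j, 0 ≤ π l i j) ∧ (∀ l i, ∑ j, π l i j = P.p l i) ∧
    ∀ l l' j, ∑ i, π l i j = ∑ i, π l' i j}

/-- `ε`-stationary points of `max_{U ∈ St(d,k)} min_{π ∈ Π(p)} f(π, U)`. -/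
def Data.IsStationary (P : Data m n d) (ε : ℝ) (π : Fin m → Matrix (Fin n) (Fin n) ℝ)
    (U : Matrix (Fin d) (Fin k) ℝ) : Prop :=
  π ∈ P.couplings ∧ U ∈ stiefel d k ∧
    ‖riemannianGrad (fun W => P.f π W) U‖ ≤ ε ∧
    ∃ πopt ∈ P.couplings, IsMinOn (fun π' => P.f π' U) P.couplings πopt ∧
      P.f π U - P.f πopt U ≤ ε

/-! ### The dual function -/

/-- The matrices `ζ(u^l, v^l, U)`. -/
def Data.zeta (P : Data m n d) (η : ℝ) (u v : Fin m → Fin n → ℝ)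
    (U : Matrix (Fin d) (Fin k) ℝ) (l : Fin m) : Matrix (Fin n) (Fin n) ℝ :=
  Matrix.of fun i j => Real.exp (-(P.projCost U l i j) / η + u l i + v l j)

/-- The normalized matrices `π(u^l, v^l, U) = ζ / ‖ζ‖₁` (the entries of `ζ` are positive). -/
def Data.piDual (P : Data m n d) (η : ℝ) (u v : Fin m → Fin n → ℝ)
    (U : Matrix (Fin d) (Fin k) ℝ) (l : Fin m) : Matrix (Fin n) (Fin n) ℝ :=
  Matrix.of fun i j => P.zeta η u v U l i j / ∑ i', ∑ j', P.zeta η u v U l i' j'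

/-- The dual objective `g(u, v, U)`. -/
def Data.g (P : Data m n d) (η : ℝ) (u v : Fin m → Fin n → ℝ)
    (U : Matrix (Fin d) (Fin k) ℝ) : ℝ :=
  ∑ l, P.w l * (Real.log (∑ i, ∑ j, P.zeta η u v U l i j) - ∑ i, u l i * P.p l i)

/-! ### The updates of the block coordinate descent -/

/-- `u^l + log (p^l / (ζ(u^l, v^l, U) 1))`. -/
def Data.uUpdate (P : Data m n d) (η : ℝ) (u v : Fin m → Fin n → ℝ)
    (U : Matrix (Fin d) (Fin k) ℝ) : Fin m → Fin n → ℝ :=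
  fun l i => u l i + Real.log (P.p l i / ∑ j, P.zeta η u v U l i j)

/-- The column sums `ζ(u^l, v^l, U)ᵀ 1`. -/
def Data.colSum (P : Data m n d) (η : ℝ) (u v : Fin m → Fin n → ℝ)
    (U : Matrix (Fin d) (Fin k) ℝ) : Fin m → Fin n → ℝ :=
  fun l j => ∑ i, P.zeta η u v U l i j

/-- The weighted geometric mean of vectors `q^l`. -/
def Data.geomMean (P : Data m n d) (q : Fin m → Fin n → ℝ) : Fin n → ℝ :=
  fun j => Real.exp (∑ l, P.w l * Real.log (q l j))

/-- The weighted arithmetic mean of vectors `q^l`. -/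
def Data.arithMean (P : Data m n d) (q : Fin m → Fin n → ℝ) : Fin n → ℝ :=
  fun j => ∑ l, P.w l * q l j

/-- `v^l + log (q / q^l)`, where `q^l = ζ(u^l, v^l, U)ᵀ 1` and `q` is the geometric mean of the
`q^l`; here `u` is the already updated vector. -/
def Data.vUpdate (P : Data m n d) (η : ℝ) (u v : Fin m → Fin n → ℝ)
    (U : Matrix (Fin d) (Fin k) ℝ) : Fin m → Fin n → ℝ :=
  fun l j => v l j + Real.log (P.geomMean (P.colSum η u v U) j / P.colSum η u v U l j)

/-- The rounding procedure `Round(π, p, q)`. If `err_p = 0` then the output is `π''`, which is what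
the convention `x / 0 = 0` gives. -/
def round (π : Matrix (Fin n) (Fin n) ℝ) (p q : Fin n → ℝ) : Matrix (Fin n) (Fin n) ℝ :=
  let π' : Matrix (Fin n) (Fin n) ℝ := Matrix.diagonal (fun i => min (p i / ∑ j, π i j) 1) * π
  let π'' : Matrix (Fin n) (Fin n) ℝ := π' * Matrix.diagonal (fun j => min (q j / ∑ i, π' i j) 1)
  let errp : Fin n → ℝ := fun i => p i - ∑ j, π'' i j
  let errq : Fin n → ℝ := fun j => q j - ∑ i, π'' i j
  Matrix.of fun i j => π'' i j + errp i * errq j / l1Norm errp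

/-! ### The algorithm -/

/-- The parameter `η = ε / (4 log n + 2)`. -/
def etaParam (n : ℕ) (ε : ℝ) : ℝ := ε / (4 * Real.log n + 2)

/-- The parameter `ρ = 2 c̄ / η + 4 c̄² / η²`. -/
def Data.rhoParam (P : Data m n d) (ε : ℝ) : ℝ :=
  2 * P.cbar / etaParam n ε + 4 * P.cbar ^ 2 / etaParam n ε ^ 2

/-- The step size `τ = 1 / (4 L₂ c̄ / η + ρ L₁²)`. -/
def Data.tauParam (P : Data m n d) (ε L₁ L₂ : ℝ) : ℝ :=
  1 / (4 * L₂ * P.cbar / etaParam n ε + P.rhoParam ε * L₁ ^ 2)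

/-- An iterate `(u_t, v_t, U_t)`. -/
structure Iterate (m n d k : ℕ) where
  u : Fin m → Fin n → ℝ
  v : Fin m → Fin n → ℝ
  U : Matrix (Fin d) (Fin k) ℝ

/-- `u_{t+1}`, as a function of the `t`-th iterate. -/
def Iterate.uNext (s : Iterate m n d k) (P : Data m n d) (ε : ℝ) : Fin m → Fin n → ℝ :=
  P.uUpdate (etaParam n ε) s.u s.v s.U

/-- `v_{t+1}`, as a function of the `t`-th iterate. -/
def Iterate.vNext (s : Iterate m n d k) (P : Data m n d) (ε : ℝ) : Fin m → Fin n → ℝ :=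
  P.vUpdate (etaParam n ε) (s.uNext P ε) s.v s.U

/-- `grad_U g(u_{t+1}, v_{t+1}, U_t)`, as a function of the `t`-th iterate. -/
def Iterate.gradNext (s : Iterate m n d k) (P : Data m n d) (ε : ℝ) : Matrix (Fin d) (Fin k) ℝ :=
  riemannianGrad (fun W => P.g (etaParam n ε) (s.uNext P ε) (s.vNext P ε) W) s.U

/-- One iteration: the updates of `u` and `v` and a Riemannian gradient step in `U`. -/
def Iterate.next (s : Iterate m n d k) (P : Data m n d)
    (R : Matrix (Fin d) (Fin k) ℝ → Matrix (Fin d) (Fin k) ℝ → Matrix (Fin d) (Fin k) ℝ)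
    (ε L₁ L₂ : ℝ) : Iterate m n d k where
  u := s.uNext P ε
  v := s.vNext P ε
  U := R s.U (-(P.tauParam ε L₁ L₂ • s.gradNext P ε))

/-- The `t`-th iterate of the algorithm, without a stopping test, started at `s₀`. -/
def Data.iterate (P : Data m n d)
    (R : Matrix (Fin d) (Fin k) ℝ → Matrix (Fin d) (Fin k) ℝ → Matrix (Fin d) (Fin k) ℝ)
    (ε L₁ L₂ : ℝ) (s₀ : Iterate m n d k) : ℕ → Iterate m n d k
  | 0 => s₀
  | t + 1 => (P.iterate R ε L₁ L₂ s₀ t).next P R ε L₁ L₂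

/-- The vectors `q^l_t = ζ(u^l_{t+1}, v^l_t, U_t)ᵀ 1`. -/
def Iterate.q (s : Iterate m n d k) (P : Data m n d) (ε : ℝ) : Fin m → Fin n → ℝ :=
  P.colSum (etaParam n ε) (s.uNext P ε) s.v s.U

/-- The stopping test of the iteration that starts from the iterate `s`. -/
def Iterate.Stops (s : Iterate m n d k) (P : Data m n d) (ε : ℝ) : Prop :=
  ∑ l, P.w l * l1Norm (s.q P ε l - P.arithMean (s.q P ε))
      ≤ P.wmin ^ (3 / 2 : ℝ) * ε / (12 * P.cbar) ∧
    etaParam n ε * ‖s.gradNext P ε‖ ≤ ε / 3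

/-- The coupling `π̂` that is returned if the algorithm stops in the iteration that starts from the
iterate `s`; the matrix that is returned is `s.U`. -/
def Iterate.output (s : Iterate m n d k) (P : Data m n d) (ε : ℝ) :
    Fin m → Matrix (Fin n) (Fin n) ℝ :=
  fun l => round (P.piDual (etaParam n ε) (s.uNext P ε) s.v s.U l) (P.p l) (P.arithMean (s.q P ε))

/-- The algorithm, started at `s₀`, breaks in the iteration with index `T` (the first iteration has
index `0`), that is, after `T + 1` iterations. -/
def Data.BreaksAt (P : Data m n d)
    (R : Matrix (Fin d) (Fin k) ℝ → Matrix (Fin d) (Fin k) ℝ → Matrix (Fin d) (Fin k) ℝ)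
    (ε L₁ L₂ : ℝ) (s₀ : Iterate m n d k) (T : ℕ) : Prop :=
  (P.iterate R ε L₁ L₂ s₀ T).Stops P ε ∧ ∀ t < T, ¬ (P.iterate R ε L₁ L₂ s₀ t).Stops P ε

end RPRWB

end

/-!
The existence of retraction constants is a compactness statement. Near the zero section, Taylor's
theorem along the rays `t ↦ Retr_U(t ξ)` gives a quadratic remainder, uniformly over the compact
Stiefel manifold (`IsRetraction.exists_local_bound`); away from it boundedness of the manifold is
enough.

The algorithm is a block coordinate descent on the dual function `g`, and the proof tracks the
potential `g(u_{t+1}, v_t, U_t)`. Each block decreases it: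
* the `u`-update by a Kullback-Leibler divergence (`Data.g_uUpdate_le`);
* the `v`-update by `-log ∑_j G_j`, where `G` is the geometric mean of the probability vectors `q^l`;
  a sharpened arithmetic-geometric mean inequality bounds this from below by the square of the
  dispersion `∑ w^l ‖q^l - q̄‖₁` (`Data.dispersion_sq_le`, `Data.g_vUpdate_le`);
* the gradient step by `τ / 2` times the squared norm of the Riemannian gradient, because Hoeffding's
  lemma gives a quadratic upper bound for the log-sum-exp function along the manifold
  (`Data.g_le_quadratic`, `Data.g_retraction_le`).

So the potential drops by a fixed amount as long as the stopping test fails. It is bounded below by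
weak duality, and after one round of updates it is bounded above independently of the starting point,
since `v` is then determined up to additive constants and an error `c̄ / η`
(`Data.neg_cbar_div_le_g`, `Data.g_le_of_vUpdate`). This bounds the number of iterations
(`Data.exists_breaksAt`, `Data.iterations_le`).

When the test is met, the rounded coupling differs from `ζ(u_{T+1}, v_T, U_T)` and from
`π(u_{T+1}, v_{T+1}, U_T)` in `ℓ₁` by multiples of the dispersion (`round_spec`,
`Data.wmin_mul_gap_le`, `Data.sum_abs_zeta_sub_piDual_le`). As `grad_U g` is `-1/η` times `grad_U f`
at the latter point, the Riemannian gradient of `f` is small. For the primal gap, `ζ` is optimal for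
the entropic problem with its own marginals, which costs at most `2 η log n ≤ ε / 2` in entropy and a
term `η ∑ w^l ⟨v^l, q^l⟩` (`Data.f_zeta_sub_f_le`). This term is controlled by the dispersion, also
when the algorithm stops in the first iteration with an arbitrary `v_0`: nearly equal `q^l` force `v`
to be bounded up to constants (`Data.sum_v_mul_colSum_le`).
-/

namespace RPRWB

variable {m n d k : ℕ}

/-! ### The Frobenius inner product and the Stiefel manifold -/

/-- The Frobenius inner product of matrices. -/
def frob (A B : Matrix (Fin d) (Fin k) ℝ) : ℝ := ∑ a, ∑ b, A a b * B a b

theorem frob_self (A : Matrix (Fin d) (Fin k) ℝ) : frob A A = ‖A‖ ^ 2 := by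
  rw [Matrix.frobenius_norm_def, ← Real.rpow_natCast, ← Real.rpow_mul]
  · simp [frob, sq]
  · positivity

theorem frob_eq_trace (A B : Matrix (Fin d) (Fin k) ℝ) : frob A B = (Aᵀ * B).trace := by
  simp only [frob, Matrix.trace, Matrix.diag, Matrix.mul_apply, Matrix.transpose_apply]
  exact Finset.sum_comm

theorem frob_add_right (A B C : Matrix (Fin d) (Fin k) ℝ) :
    frob A (B + C) = frob A B + frob A C := by
  simp [frob, mul_add, Finset.sum_add_distrib]

theorem frob_sub_left (A B C : Matrix (Fin d) (Fin k) ℝ) :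
    frob (A - B) C = frob A C - frob B C := by
  simp [frob, sub_mul, Finset.sum_sub_distrib]

theorem frob_smul_left (c : ℝ) (A B : Matrix (Fin d) (Fin k) ℝ) :
    frob (c • A) B = c * frob A B := by
  simp [frob, Finset.mul_sum, mul_assoc]

theorem frob_smul_right (c : ℝ) (A B : Matrix (Fin d) (Fin k) ℝ) :
    frob A (c • B) = c * frob A B := by
  simp only [frob, Finset.mul_sum, Matrix.smul_apply, smul_eq_mul]
  exact Finset.sum_congr rfl fun a _ => Finset.sum_congr rfl fun b _ => by ring

theorem frob_sum_left {ι : Type*} (s : Finset ι) (A : ι → Matrix (Fin d) (Fin k) ℝ)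
    (B : Matrix (Fin d) (Fin k) ℝ) : frob (∑ i ∈ s, A i) B = ∑ i ∈ s, frob (A i) B := by
  classical
  induction s using Finset.induction_on with
  | empty => simp [frob]
  | insert i s hi ih =>
    have h : ∀ A A' : Matrix (Fin d) (Fin k) ℝ, frob (A + A') B = frob A B + frob A' B := by
      intro A A'
      simp [frob, add_mul, Finset.sum_add_distrib]
    rw [Finset.sum_insert hi, Finset.sum_insert hi, h, ih]

theorem frob_single (A : Matrix (Fin d) (Fin k) ℝ) (a : Fin d) (b : Fin k) :
    frob A (Matrix.single a b (1 : ℝ)) = A a b := by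
  rw [frob, Finset.sum_eq_single a, Finset.sum_eq_single b]
  · simp
  · intro b' _ hb'
    simp [Matrix.single, Ne.symm hb']
  · simp
  · intro a' _ ha'
    simp [Matrix.single, Ne.symm ha']
  · simp

theorem abs_frob_le (A B : Matrix (Fin d) (Fin k) ℝ) : |frob A B| ≤ ‖A‖ * ‖B‖ := by
  refine abs_le_of_sq_le_sq ?_ (by positivity)
  rw [mul_pow, ← frob_self, ← frob_self]
  simp only [frob, ← Finset.sum_product', ← sq]
  exact Finset.sum_mul_sq_le_sq_mul_sq _ _ _

theorem norm_le_of_frob_le {A : Matrix (Fin d) (Fin k) ℝ} {c : ℝ} (hc : 0 ≤ c)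
    (h : ∀ B, frob A B ≤ c * ‖B‖) : ‖A‖ ≤ c := by
  have h1 := h A
  rw [frob_self, sq] at h1
  rcases (norm_nonneg A).eq_or_lt with h0 | h0
  · rwa [← h0]
  · exact le_of_mul_le_mul_right h1 h0

theorem tangentProj_sub (U G H : Matrix (Fin d) (Fin k) ℝ) :
    tangentProj U (G - H) = tangentProj U G - tangentProj U H := by
  simp only [tangentProj, Matrix.mul_sub, Matrix.transpose_sub, Matrix.sub_mul, Matrix.mul_add,
    smul_sub, smul_add]
  abel

theorem tangentProj_smul (c : ℝ) (U G : Matrix (Fin d) (Fin k) ℝ) :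
    tangentProj U (c • G) = c • tangentProj U G := by
  simp only [tangentProj, Matrix.mul_smul, Matrix.transpose_smul, Matrix.smul_mul, Matrix.mul_add,
    smul_sub, smul_add]
  simp only [smul_comm c]

theorem frob_tangentProj {U : Matrix (Fin d) (Fin k) ℝ} (G : Matrix (Fin d) (Fin k) ℝ)
    {ξ : Matrix (Fin d) (Fin k) ℝ} (hξ : ξ ∈ tangentSpace U) :
    frob (tangentProj U G) ξ = frob G ξ := by
  have h := tangentProj_residual_orthogonal G hξ
  rw [← frob_eq_trace, frob_sub_left] at h
  linarith

theorem norm_tangentProj_le {U : Matrix (Fin d) (Fin k) ℝ} (hU : U ∈ stiefel d k)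
    (G : Matrix (Fin d) (Fin k) ℝ) : ‖tangentProj U G‖ ≤ ‖G‖ := by
  have h := frob_tangentProj G (tangentProj_mem hU G)
  rw [frob_self] at h
  have h2 := (le_abs_self _).trans (abs_frob_le G (tangentProj U G))
  rcases (norm_nonneg (tangentProj U G)).eq_or_lt with h0 | h0
  · rw [← h0]; exact norm_nonneg _
  · nlinarith

theorem smul_mem_tangentSpace {U ξ : Matrix (Fin d) (Fin k) ℝ} (c : ℝ)
    (hξ : ξ ∈ tangentSpace U) : c • ξ ∈ tangentSpace U := by
  have h : Uᵀ * ξ + ξᵀ * U = 0 := hξ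
  change Uᵀ * (c • ξ) + (c • ξ)ᵀ * U = 0
  rw [Matrix.mul_smul, Matrix.transpose_smul, Matrix.smul_mul, ← smul_add, h, smul_zero]

theorem norm_sq_of_mem_stiefel {U : Matrix (Fin d) (Fin k) ℝ} (hU : U ∈ stiefel d k) :
    ‖U‖ ^ 2 = k := by
  have h : Uᵀ * U = 1 := hU
  rw [← frob_self, frob_eq_trace, h, Matrix.trace_one, Fintype.card_fin]

theorem norm_of_mem_stiefel {U : Matrix (Fin d) (Fin k) ℝ} (hU : U ∈ stiefel d k) :
    ‖U‖ = √k := by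
  rw [← norm_sq_of_mem_stiefel hU, Real.sqrt_sq (norm_nonneg _)]

theorem sqNorm_nonneg {q : ℕ} (z : Fin q → ℝ) : 0 ≤ sqNorm z :=
  Finset.sum_nonneg fun _ _ => sq_nonneg _

theorem sqNorm_eq_dotProduct {q : ℕ} (z : Fin q → ℝ) : sqNorm z = z ⬝ᵥ z := by
  simp [sqNorm, dotProduct, sq]

theorem sqNorm_add {q : ℕ} (x y : Fin q → ℝ) :
    sqNorm (x + y) = sqNorm x + 2 * (x ⬝ᵥ y) + sqNorm y := by
  simp only [sqNorm_eq_dotProduct, add_dotProduct, dotProduct_add, dotProduct_comm y x]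
  ring

theorem dotProduct_sq_le {q : ℕ} (x y : Fin q → ℝ) : (x ⬝ᵥ y) ^ 2 ≤ sqNorm x * sqNorm y :=
  Finset.sum_mul_sq_le_sq_mul_sq _ _ _

theorem sqNorm_transpose_mulVec_le_of_mem_stiefel {U : Matrix (Fin d) (Fin k) ℝ}
    (hU : U ∈ stiefel d k) (z : Fin d → ℝ) : sqNorm (Uᵀ *ᵥ z) ≤ sqNorm z := by
  have h : Uᵀ * U = 1 := hU
  have h1 : sqNorm (U *ᵥ (Uᵀ *ᵥ z)) = sqNorm (Uᵀ *ᵥ z) := by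
    rw [sqNorm_eq_dotProduct, dotProduct_mulVec, vecMul_mulVec, h, vecMul_one,
      sqNorm_eq_dotProduct]
  have h2 : z ⬝ᵥ (U *ᵥ (Uᵀ *ᵥ z)) = sqNorm (Uᵀ *ᵥ z) := by
    rw [dotProduct_mulVec, ← mulVec_transpose, sqNorm_eq_dotProduct]
  have h3 := dotProduct_sq_le z (U *ᵥ (Uᵀ *ᵥ z))
  rw [h1, h2] at h3
  rcases (sqNorm_nonneg (Uᵀ *ᵥ z)).eq_or_lt with h0 | h0
  · rw [← h0]; exact sqNorm_nonneg _
  · nlinarith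

theorem sqNorm_transpose_mulVec_le (D : Matrix (Fin d) (Fin k) ℝ) (z : Fin d → ℝ) :
    sqNorm (Dᵀ *ᵥ z) ≤ ‖D‖ ^ 2 * sqNorm z := by
  rw [← frob_self, frob, Finset.sum_comm, sqNorm, Finset.sum_mul]
  refine Finset.sum_le_sum fun b _ => ?_
  simp only [← sq]
  exact Finset.sum_mul_sq_le_sq_mul_sq Finset.univ (fun a => D a b) z

theorem abs_dotProduct_transpose_mulVec_le {U : Matrix (Fin d) (Fin k) ℝ} (hU : U ∈ stiefel d k)
    (D : Matrix (Fin d) (Fin k) ℝ) (z : Fin d → ℝ) :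
    |(Uᵀ *ᵥ z) ⬝ᵥ (Dᵀ *ᵥ z)| ≤ sqNorm z * ‖D‖ := by
  have hz := sqNorm_nonneg z
  refine abs_le_of_sq_le_sq ?_ (by positivity)
  calc _ ≤ sqNorm (Uᵀ *ᵥ z) * sqNorm (Dᵀ *ᵥ z) := dotProduct_sq_le _ _
    _ ≤ sqNorm z * (‖D‖ ^ 2 * sqNorm z) :=
      mul_le_mul (sqNorm_transpose_mulVec_le_of_mem_stiefel hU z) (sqNorm_transpose_mulVec_le D z)
        (sqNorm_nonneg _) hz
    _ = _ := by ring

/-! ### Costs and explicit gradients -/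

theorem Data.cost_le_cbar (P : Data m n d) (l : Fin m) (i j : Fin n) : P.cost l i j ≤ P.cbar :=
  le_ciSup (f := fun z : Fin m × Fin n × Fin n => P.cost z.1 z.2.1 z.2.2)
    (Set.finite_range _).bddAbove (l, i, j)

theorem Data.projCost_nonneg (P : Data m n d) (U : Matrix (Fin d) (Fin k) ℝ) (l : Fin m)
    (i j : Fin n) : 0 ≤ P.projCost U l i j := sqNorm_nonneg _

theorem Data.projCost_le_cbar (P : Data m n d) {U : Matrix (Fin d) (Fin k) ℝ}
    (hU : U ∈ stiefel d k) (l : Fin m) (i j : Fin n) : P.projCost U l i j ≤ P.cbar :=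
  (sqNorm_transpose_mulVec_le_of_mem_stiefel hU _).trans (P.cost_le_cbar l i j)

/-- Half of the directional derivative of the projected cost at `U` in the direction `D`. -/
def Data.cross (P : Data m n d) (U D : Matrix (Fin d) (Fin k) ℝ) (l : Fin m) (i j : Fin n) : ℝ :=
  (Uᵀ *ᵥ (P.X l i - P.Y j)) ⬝ᵥ (Dᵀ *ᵥ (P.X l i - P.Y j))

theorem Data.projCost_add (P : Data m n d) (U D : Matrix (Fin d) (Fin k) ℝ) (l : Fin m)
    (i j : Fin n) :
    P.projCost (U + D) l i j = P.projCost U l i j + 2 * P.cross U D l i j + P.projCost D l i j := by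
  simp only [Data.projCost, Data.cross, Matrix.transpose_add, Matrix.add_mulVec, sqNorm_add]

theorem Data.cross_smul (P : Data m n d) (U D : Matrix (Fin d) (Fin k) ℝ) (c : ℝ) (l : Fin m)
    (i j : Fin n) : P.cross U (c • D) l i j = c * P.cross U D l i j := by
  simp [Data.cross, Matrix.transpose_smul, Matrix.smul_mulVec, dotProduct_smul]

theorem Data.projCost_smul (P : Data m n d) (D : Matrix (Fin d) (Fin k) ℝ) (c : ℝ) (l : Fin m)
    (i j : Fin n) : P.projCost (c • D) l i j = c ^ 2 * P.projCost D l i j := by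
  simp [Data.projCost, sqNorm, Matrix.transpose_smul, Matrix.smul_mulVec, mul_pow, Finset.mul_sum]

theorem Data.abs_cross_le (P : Data m n d) {U : Matrix (Fin d) (Fin k) ℝ} (hU : U ∈ stiefel d k)
    (D : Matrix (Fin d) (Fin k) ℝ) (l : Fin m) (i j : Fin n) :
    |P.cross U D l i j| ≤ P.cbar * ‖D‖ :=
  (abs_dotProduct_transpose_mulVec_le hU D _).trans
    (mul_le_mul_of_nonneg_right (P.cost_le_cbar l i j) (norm_nonneg _))

/-- The projected cost is Lipschitz on the Stiefel manifold. -/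
theorem Data.abs_projCost_sub_le (P : Data m n d) {U V : Matrix (Fin d) (Fin k) ℝ}
    (hU : U ∈ stiefel d k) (hV : V ∈ stiefel d k) (l : Fin m) (i j : Fin n) :
    |P.projCost V l i j - P.projCost U l i j| ≤ 2 * P.cbar * ‖V - U‖ := by
  have h1 : P.projCost V l i j - P.projCost U l i j
      = P.cross U (V - U) l i j + P.cross V (V - U) l i j := by
    simp only [Data.projCost, Data.cross, sqNorm_eq_dotProduct, Matrix.transpose_sub,
      Matrix.sub_mulVec, dotProduct_sub]
    rw [dotProduct_comm (Vᵀ *ᵥ _) (Uᵀ *ᵥ _)]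
    ring
  rw [h1]
  have h2 := P.abs_cross_le hU (V - U) l i j
  have h3 := P.abs_cross_le hV (V - U) l i j
  have h4 := abs_add_le (P.cross U (V - U) l i j) (P.cross V (V - U) l i j)
  linarith

/-- The matrix `z (Uᵀ z)ᵀ` with `z = x^l_i - y_j`: half of the Euclidean gradient of the projected
cost. -/
def Data.halfGrad (P : Data m n d) (U : Matrix (Fin d) (Fin k) ℝ) (l : Fin m) (i j : Fin n) :
    Matrix (Fin d) (Fin k) ℝ :=
  Matrix.vecMulVec (P.X l i - P.Y j) (Uᵀ *ᵥ (P.X l i - P.Y j))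

theorem Data.frob_halfGrad (P : Data m n d) (U D : Matrix (Fin d) (Fin k) ℝ) (l : Fin m)
    (i j : Fin n) : frob (P.halfGrad U l i j) D = P.cross U D l i j := by
  simp only [Data.halfGrad, Data.cross, frob, dotProduct, mulVec, Matrix.transpose_apply,
    Matrix.vecMulVec_apply]
  rw [Finset.sum_comm]
  refine Finset.sum_congr rfl fun b _ => ?_
  rw [Finset.mul_sum]
  exact Finset.sum_congr rfl fun a _ => by ring

/-- The Euclidean gradient of `U ↦ ∑ w^l π^l_ij ‖Uᵀ (x^l_i - y_j)‖²`. -/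
def Data.quadGrad (P : Data m n d) (π : Fin m → Matrix (Fin n) (Fin n) ℝ)
    (U : Matrix (Fin d) (Fin k) ℝ) : Matrix (Fin d) (Fin k) ℝ :=
  ∑ l, P.w l • ∑ i, ∑ j, (2 * π l i j) • P.halfGrad U l i j

theorem Data.frob_quadGrad (P : Data m n d) (π : Fin m → Matrix (Fin n) (Fin n) ℝ)
    (U D : Matrix (Fin d) (Fin k) ℝ) :
    frob (P.quadGrad π U) D = ∑ l, P.w l * ∑ i, ∑ j, π l i j * (2 * P.cross U D l i j) := by
  simp only [Data.quadGrad, frob_sum_left, frob_smul_left, P.frob_halfGrad]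
  simp only [mul_left_comm, mul_assoc]

theorem Data.frob_quadGrad_sub_le (P : Data m n d) (hw : ∀ l, 0 < P.w l)
    (π π' : Fin m → Matrix (Fin n) (Fin n) ℝ)
    {U : Matrix (Fin d) (Fin k) ℝ} (hU : U ∈ stiefel d k) (D : Matrix (Fin d) (Fin k) ℝ) :
    frob (P.quadGrad π U - P.quadGrad π' U) D
      ≤ 2 * P.cbar * (∑ l, P.w l * ∑ i, ∑ j, |π l i j - π' l i j|) * ‖D‖ := by
  rw [frob_sub_left, P.frob_quadGrad, P.frob_quadGrad, ← Finset.sum_sub_distrib, Finset.mul_sum,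
    Finset.sum_mul]
  refine Finset.sum_le_sum fun l _ => ?_
  rw [← mul_sub, mul_left_comm, mul_assoc]
  refine mul_le_mul_of_nonneg_left ?_ (hw l).le
  simp only [← Finset.sum_sub_distrib, Finset.mul_sum, Finset.sum_mul]
  refine Finset.sum_le_sum fun i _ => Finset.sum_le_sum fun j _ => ?_
  calc _ = (π l i j - π' l i j) * (2 * P.cross U D l i j) := by ring
    _ ≤ |π l i j - π' l i j| * |2 * P.cross U D l i j| := by
      rw [← abs_mul]; exact le_abs_self _
    _ ≤ |π l i j - π' l i j| * (2 * (P.cbar * ‖D‖)) := by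
      rw [abs_mul, abs_two]
      exact mul_le_mul_of_nonneg_left
        (mul_le_mul_of_nonneg_left (P.abs_cross_le hU D l i j) zero_le_two) (abs_nonneg _)
    _ = _ := by ring

theorem Data.quadGrad_zero (P : Data m n d) (U : Matrix (Fin d) (Fin k) ℝ) :
    P.quadGrad (fun _ => 0) U = 0 := by
  simp [Data.quadGrad]

theorem Data.norm_quadGrad_sub_le (P : Data m n d) (hw : ∀ l, 0 < P.w l) (hc : 0 ≤ P.cbar)
    (π π' : Fin m → Matrix (Fin n) (Fin n) ℝ)
    {U : Matrix (Fin d) (Fin k) ℝ} (hU : U ∈ stiefel d k) :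
    ‖P.quadGrad π U - P.quadGrad π' U‖
      ≤ 2 * P.cbar * (∑ l, P.w l * ∑ i, ∑ j, |π l i j - π' l i j|) := by
  refine norm_le_of_frob_le ?_ (P.frob_quadGrad_sub_le hw π π' hU)
  have : 0 ≤ ∑ l, P.w l * ∑ i, ∑ j, |π l i j - π' l i j| :=
    Finset.sum_nonneg fun l _ => mul_nonneg (hw l).le
      (Finset.sum_nonneg fun i _ => Finset.sum_nonneg fun j _ => abs_nonneg _)
  positivity

theorem euclideanGrad_eq {F : Matrix (Fin d) (Fin k) ℝ → ℝ} {U G : Matrix (Fin d) (Fin k) ℝ}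
    (h : ∀ D, HasDerivAt (fun s : ℝ => F (U + s • D)) (frob G D) 0) : euclideanGrad F U = G := by
  ext a b
  rw [euclideanGrad, Matrix.of_apply, (h _).deriv, frob_single]

theorem Data.hasDerivAt_projCost (P : Data m n d) (U D : Matrix (Fin d) (Fin k) ℝ) (l : Fin m)
    (i j : Fin n) :
    HasDerivAt (fun s : ℝ => P.projCost (U + s • D) l i j) (2 * P.cross U D l i j) 0 := by
  simp only [P.projCost_add, P.cross_smul, P.projCost_smul]
  have h1 := (((hasDerivAt_id (0 : ℝ)).mul_const (P.cross U D l i j)).const_mul 2).const_add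
    (P.projCost U l i j)
  have h2 := ((hasDerivAt_id (0 : ℝ)).pow 2).mul_const (P.projCost D l i j)
  simpa using h1.fun_add h2

theorem Data.euclideanGrad_f (P : Data m n d) (π : Fin m → Matrix (Fin n) (Fin n) ℝ)
    (U : Matrix (Fin d) (Fin k) ℝ) : euclideanGrad (fun W => P.f π W) U = P.quadGrad π U := by
  refine euclideanGrad_eq fun D => ?_
  rw [P.frob_quadGrad]
  exact HasDerivAt.fun_sum fun l _ => (HasDerivAt.fun_sum fun i _ => HasDerivAt.fun_sum fun j _ =>
    (P.hasDerivAt_projCost U D l i j).const_mul _).const_mul _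

theorem Data.zeta_pos (P : Data m n d) (η : ℝ) (u v : Fin m → Fin n → ℝ)
    (U : Matrix (Fin d) (Fin k) ℝ) (l : Fin m) (i j : Fin n) : 0 < P.zeta η u v U l i j :=
  Real.exp_pos _

theorem Data.euclideanGrad_g (P : Data m n d) (hn : 0 < n) (η : ℝ) (u v : Fin m → Fin n → ℝ)
    (U : Matrix (Fin d) (Fin k) ℝ) :
    euclideanGrad (fun W => P.g η u v W) U = (-(1 / η)) • P.quadGrad (P.piDual η u v U) U := by
  have : Nonempty (Fin n) := ⟨⟨0, hn⟩⟩
  refine euclideanGrad_eq fun D => ?_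
  have hS : ∀ l, 0 < ∑ i, ∑ j, P.zeta η u v U l i j := fun l =>
    Finset.sum_pos (fun i _ => Finset.sum_pos (fun j _ => P.zeta_pos η u v U l i j)
      Finset.univ_nonempty) Finset.univ_nonempty
  have hz : ∀ l i j, HasDerivAt (fun s : ℝ => P.zeta η u v (U + s • D) l i j)
      (P.zeta η u v U l i j * (-(2 * P.cross U D l i j) / η)) 0 := by
    intro l i j
    have h := (((((P.hasDerivAt_projCost U D l i j).neg).div_const η).add_const
      (u l i)).add_const (v l j)).exp
    simpa [Data.zeta] using h
  have hsum : ∀ l, HasDerivAt (fun s : ℝ => ∑ i, ∑ j, P.zeta η u v (U + s • D) l i j)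
      (∑ i, ∑ j, P.zeta η u v U l i j * (-(2 * P.cross U D l i j) / η)) 0 := fun l =>
    HasDerivAt.fun_sum fun i _ => HasDerivAt.fun_sum fun j _ => hz l i j
  have hg : HasDerivAt (fun s : ℝ => P.g η u v (U + s • D)) _ 0 :=
    HasDerivAt.fun_sum fun l _ => (((hsum l).log (by simpa using (hS l).ne')).sub_const
      (∑ i, u l i * P.p l i)).const_mul (P.w l)
  refine hg.congr_deriv ?_
  rw [frob_smul_left, P.frob_quadGrad, Finset.mul_sum]
  refine Finset.sum_congr rfl fun l _ => ?_
  simp only [zero_smul, add_zero, Finset.sum_div, Data.piDual, Matrix.of_apply, Finset.mul_sum]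
  exact Finset.sum_congr rfl fun i _ => Finset.sum_congr rfl fun j _ => by ring

/-! ### First and second order constants of a retraction -/

/-- Taylor's theorem along segments that stay in a set `B` which need not have unique
derivatives: the first order term is whatever the one-sided derivative along the segment is, and
the remainder is quadratic with a locally uniform constant. -/
theorem exists_quadratic_remainder {E F : Type*} [NormedAddCommGroup E] [NormedSpace ℝ E]
    [NormedAddCommGroup F] [NormedSpace ℝ F] {f : E → F} {B : Set E} {x : E} (hx : x ∈ B)
    (hf : ContDiffWithinAt ℝ 2 f B x) :
    ∃ δ > 0, ∃ M ≥ 0, ∀ y v : E, (∀ t ∈ Icc (0 : ℝ) 1, y + t • v ∈ B ∧ ‖y + t • v - x‖ < δ) →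
      ∃ w, HasDerivWithinAt (fun t : ℝ => f (y + t • v)) w (Icc 0 1) 0 ∧
        ‖f (y + v) - f y - w‖ ≤ M * ‖v‖ ^ 2 := by
  have h2 : (2 : WithTop ℕ∞) = 1 + 1 := by norm_num
  rw [h2, contDiffWithinAt_succ_iff_hasFDerivWithinAt (by simp)] at hf
  obtain ⟨u, hu, -, f', hf', hc⟩ := hf
  have h1 : (1 : WithTop ℕ∞) = 0 + 1 := by norm_num
  rw [insert_eq_of_mem hx] at hu
  have hxu : x ∈ u := mem_of_mem_nhdsWithin hx hu
  rw [h1, contDiffWithinAt_succ_iff_hasFDerivWithinAt (by simp)] at hc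
  obtain ⟨u', hu', -, f'', hf'', hc'⟩ := hc
  rw [insert_eq_of_mem hxu] at hu'
  have hxu' : x ∈ u' := mem_of_mem_nhdsWithin hxu hu'
  have hcont : ContinuousWithinAt f'' u' x := hc'.continuousWithinAt
  have hbd : ∀ᶠ y in 𝓝[u'] x, ‖f'' y‖ < ‖f'' x‖ + 1 :=
    hcont.norm.eventually (gt_mem_nhds (lt_add_one _))
  have hB : ∀ᶠ y in 𝓝[B] x, y ∈ u ∧ y ∈ u' ∧ ‖f'' y‖ < ‖f'' x‖ + 1 := by
    have e1 : 𝓝[B] x ≤ 𝓝[u] x := nhdsWithin_le_of_mem hu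
    have e2 : 𝓝[u] x ≤ 𝓝[u'] x := nhdsWithin_le_of_mem hu'
    filter_upwards [hu, e1 hu', (e1.trans e2) hbd] with y h1 h2 h3 using ⟨h1, h2, h3⟩
  obtain ⟨δ, hδ, hball⟩ := Metric.mem_nhdsWithin_iff.1 hB
  refine ⟨δ, hδ, ‖f'' x‖ + 1, by positivity, fun y v hseg => ?_⟩
  have hγ : ∀ t ∈ Icc (0 : ℝ) 1, y + t • v ∈ u ∧ y + t • v ∈ u' ∧
      ‖f'' (y + t • v)‖ < ‖f'' x‖ + 1 := fun t ht =>
    hball ⟨by rw [Metric.mem_ball, dist_eq_norm]; exact (hseg t ht).2, (hseg t ht).1⟩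
  have hγd : ∀ t, HasDerivWithinAt (fun t : ℝ => y + t • v) v (Icc 0 1) t := fun t => by
    simpa using (((hasDerivAt_id t).smul_const v).const_add y).hasDerivWithinAt
  have hφ : ∀ t ∈ Icc (0 : ℝ) 1,
      HasDerivWithinAt (fun t : ℝ => f (y + t • v)) (f' (y + t • v) v) (Icc 0 1) t := fun t ht =>
    (hf' _ (hγ t ht).1).comp_hasDerivWithinAt t (hγd t) fun s hs => (hγ s hs).1
  have hψ : ∀ t ∈ Icc (0 : ℝ) 1, HasDerivWithinAt (fun t : ℝ => f' (y + t • v) v)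
      (f'' (y + t • v) v v) (Icc 0 1) t := fun t ht =>
    by
    have h := (hf'' _ (hγ t ht).2.1).comp_hasDerivWithinAt t (hγd t) fun s hs => (hγ s hs).2.1
    simpa using h.clm_apply (hasDerivWithinAt_const t _ v)
  have h0 : (0 : ℝ) ∈ Icc (0 : ℝ) 1 := by simp
  have h1' : (1 : ℝ) ∈ Icc (0 : ℝ) 1 := by simp
  set C := (‖f'' x‖ + 1) * ‖v‖ ^ 2 with hC
  have hψ' : ∀ t ∈ Icc (0 : ℝ) 1, ‖f' (y + t • v) v - f' (y + (0 : ℝ) • v) v‖ ≤ C := by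
    intro t ht
    have h := (convex_Icc (0 : ℝ) 1).norm_image_sub_le_of_norm_hasDerivWithin_le hψ
      (C := C) (fun s hs => ?_) h0 ht
    · refine h.trans ?_
      rw [sub_zero, Real.norm_of_nonneg ht.1]
      exact mul_le_of_le_one_right (by positivity) ht.2
    · calc _ ≤ ‖f'' (y + s • v)‖ * ‖v‖ * ‖v‖ := ContinuousLinearMap.le_opNorm₂ _ _ _
        _ ≤ (‖f'' x‖ + 1) * ‖v‖ * ‖v‖ := by
          gcongr
          exact (hγ s hs).2.2.le
        _ = C := by rw [hC]; ring
  refine ⟨f' (y + (0 : ℝ) • v) v, hφ 0 h0, ?_⟩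
  have h := (convex_Icc (0 : ℝ) 1).norm_image_sub_le_of_norm_hasDerivWithin_le
    (f := fun t : ℝ => f (y + t • v) - t • f' (y + (0 : ℝ) • v) v)
    (f' := fun t : ℝ => f' (y + t • v) v - f' (y + (0 : ℝ) • v) v)
    (fun t ht => by
      simpa using (hφ t ht).fun_sub
        (((hasDerivAt_id t).smul_const (f' (y + (0 : ℝ) • v) v)).hasDerivWithinAt))
    hψ' h0 h1'
  simp only [one_smul, zero_smul, add_zero, sub_zero, norm_one, mul_one] at h
  convert h using 2
  simp only [zero_smul, add_zero]
  abel

theorem isCompact_stiefel (d k : ℕ) : IsCompact (stiefel d k) := by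
  have : ProperSpace (Matrix (Fin d) (Fin k) ℝ) := FiniteDimensional.proper ℝ _
  refine Metric.isCompact_of_isClosed_isBounded ?_ ?_
  · refine isClosed_eq ?_ continuous_const
    exact (continuous_id.matrix_transpose).matrix_mul continuous_id
  · refine isBounded_iff_forall_norm_le.2 ⟨√k, fun U hU => (norm_of_mem_stiefel hU).le⟩

theorem IsRetraction.hasDerivWithinAt
    {R : Matrix (Fin d) (Fin k) ℝ → Matrix (Fin d) (Fin k) ℝ → Matrix (Fin d) (Fin k) ℝ}
    (hR : IsRetraction R) {U ξ : Matrix (Fin d) (Fin k) ℝ} (hU : U ∈ stiefel d k)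
    (hξ : ξ ∈ tangentSpace U) :
    HasDerivWithinAt (fun t : ℝ => R U (t • ξ)) ξ (Icc 0 1) 0 := by
  rcases eq_or_ne ξ 0 with rfl | h0
  · simp only [smul_zero]
    exact hasDerivWithinAt_const (0 : ℝ) (Icc (0 : ℝ) 1) (R U 0)
  have hsmul : Tendsto (fun t : ℝ => t • ξ) (𝓝[≠] 0) (𝓝[tangentSpace U \ {0}] 0) := by
    refine tendsto_nhdsWithin_iff.2 ⟨?_, ?_⟩
    · have : Continuous fun t : ℝ => t • ξ := continuous_id.smul continuous_const
      simpa using (this.tendsto 0).mono_left nhdsWithin_le_nhds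
    · filter_upwards [self_mem_nhdsWithin] with t ht
      exact ⟨smul_mem_tangentSpace t hξ, smul_ne_zero ht h0⟩
  refine HasDerivAt.hasDerivWithinAt ?_
  rw [hasDerivAt_iff_tendsto_slope_zero, tendsto_iff_norm_sub_tendsto_zero]
  have h := ((hR.first_order U hU).comp hsmul).mul_const ‖ξ‖
  rw [zero_mul] at h
  refine h.congr' ?_
  filter_upwards [self_mem_nhdsWithin] with t ht
  have ht' : t ≠ 0 := ht
  have e : t⁻¹ • (R U ((0 + t) • ξ) - R U ((0 : ℝ) • ξ)) - ξ
      = t⁻¹ • (R U (t • ξ) - (U + t • ξ)) := by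
    rw [zero_add, zero_smul, hR.zero U hU, ← sub_sub, smul_sub _ _ (t • ξ), smul_smul,
      inv_mul_cancel₀ ht', one_smul]
  rw [e, Function.comp_apply, norm_smul, norm_smul, norm_inv]
  have : ‖t‖ ≠ 0 := norm_ne_zero_iff.2 ht'
  have : ‖ξ‖ ≠ 0 := norm_ne_zero_iff.2 h0
  field_simp

/-- Near the zero section the second order bound follows from Taylor's theorem, uniformly by
compactness. -/
theorem IsRetraction.exists_local_bound
    {R : Matrix (Fin d) (Fin k) ℝ → Matrix (Fin d) (Fin k) ℝ → Matrix (Fin d) (Fin k) ℝ}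
    (hR : IsRetraction R) :
    ∃ δ > 0, ∃ M ≥ 0, ∀ U ∈ stiefel d k, ∀ ξ ∈ tangentSpace U, ‖ξ‖ < δ →
      ‖R U ξ - (U + ξ)‖ ≤ M * ‖ξ‖ ^ 2 := by
  suffices h : ∃ δ > 0, ∃ M ≥ 0, ∀ U ∈ stiefel d k, U ∈ stiefel d k → ∀ ξ ∈ tangentSpace U,
      ‖ξ‖ < δ → ‖R U ξ - (U + ξ)‖ ≤ M * ‖ξ‖ ^ 2 by
    obtain ⟨δ, hδ, M, hM, h⟩ := h
    exact ⟨δ, hδ, M, hM, fun U hU => h U hU hU⟩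
  refine (isCompact_stiefel d k).induction_on
    (p := fun s => ∃ δ > 0, ∃ M ≥ 0, ∀ U ∈ s, U ∈ stiefel d k → ∀ ξ ∈ tangentSpace U,
      ‖ξ‖ < δ → ‖R U ξ - (U + ξ)‖ ≤ M * ‖ξ‖ ^ 2) ?_ ?_ ?_ ?_
  · exact ⟨1, one_pos, 0, le_rfl, fun U hU => absurd hU (notMem_empty U)⟩
  · rintro s t hst ⟨δ, hδ, M, hM, h⟩
    exact ⟨δ, hδ, M, hM, fun U hU => h U (hst hU)⟩
  · rintro s t ⟨δ, hδ, M, hM, h⟩ ⟨δ', hδ', M', hM', h'⟩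
    refine ⟨min δ δ', lt_min hδ hδ', max M M', le_max_of_le_left hM, fun U hU hU' ξ hξ hn => ?_⟩
    rcases hU with hU | hU
    · exact (h U hU hU' ξ hξ (hn.trans_le (min_le_left _ _))).trans
        (mul_le_mul_of_nonneg_right (le_max_left _ _) (by positivity))
    · exact (h' U hU hU' ξ hξ (hn.trans_le (min_le_right _ _))).trans
        (mul_le_mul_of_nonneg_right (le_max_right _ _) (by positivity))
  · intro U₀ hU₀
    have hz : ∀ U : Matrix (Fin d) (Fin k) ℝ, (0 : Matrix (Fin d) (Fin k) ℝ) ∈ tangentSpace U := by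
      intro U; simp [tangentSpace]
    have hmem : (U₀, (0 : Matrix (Fin d) (Fin k) ℝ)) ∈ tangentBundle d k := ⟨hU₀, hz U₀⟩
    obtain ⟨δ, hδ, M, hM, h⟩ := exists_quadratic_remainder hmem
      ((hR.smooth _ hmem).of_le (m := 2) (WithTop.coe_le_coe.2 le_top))
    refine ⟨Metric.ball U₀ δ, mem_nhdsWithin_of_mem_nhds (Metric.ball_mem_nhds _ hδ), δ, hδ, M, hM,
      fun U hU hU' ξ hξ hn => ?_⟩
    have e : ∀ t : ℝ, (U, (0 : Matrix (Fin d) (Fin k) ℝ)) + t • ((0 : Matrix (Fin d) (Fin k) ℝ), ξ)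
        = (U, t • ξ) := by
      intro t; simp
    obtain ⟨w, hw, hle⟩ := h (U, 0) (0, ξ) (fun t ht => by
      rw [e]
      refine ⟨⟨hU', smul_mem_tangentSpace t hξ⟩, ?_⟩
      rw [Prod.norm_def, max_lt_iff]
      refine ⟨by simpa [dist_eq_norm] using hU, ?_⟩
      simp only [Prod.snd_sub, sub_zero, norm_smul]
      refine lt_of_le_of_lt (mul_le_of_le_one_left (norm_nonneg _) ?_) hn
      rw [Real.norm_of_nonneg ht.1]; exact ht.2)
    have hw' : w = ξ := by
      simp only [e, Function.uncurry_apply_pair] at hw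
      exact (uniqueDiffOn_Icc_zero_one 0 (by simp)).eq_deriv _ hw (hR.hasDerivWithinAt hU' hξ)
    have e1 := e 1
    rw [one_smul, one_smul] at e1
    rw [e1, hw', Function.uncurry_apply_pair, Function.uncurry_apply_pair, hR.zero U hU'] at hle
    simpa [Prod.norm_def, sub_sub] using hle

theorem IsRetraction.exists_const
    {R : Matrix (Fin d) (Fin k) ℝ → Matrix (Fin d) (Fin k) ℝ → Matrix (Fin d) (Fin k) ℝ}
    (hR : IsRetraction R) : ∃ L₁ L₂ : ℝ, IsRetractionConst R L₁ L₂ := by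
  obtain ⟨δ, hδ, M, hM, h⟩ := hR.exists_local_bound
  -- Away from the zero section boundedness of the Stiefel manifold suffices.
  have hfar : ∀ U ∈ stiefel d k, ∀ ξ ∈ tangentSpace U, ‖R U ξ - U‖ ≤ 2 * √k := by
    intro U hU ξ hξ
    have := norm_sub_le (R U ξ) U
    rw [norm_of_mem_stiefel hU, norm_of_mem_stiefel (hR.mapsTo U hU ξ hξ)] at this
    linarith
  have hk : 0 ≤ √(k : ℝ) := Real.sqrt_nonneg _
  have hsplit : ∀ U ξ : Matrix (Fin d) (Fin k) ℝ, R U ξ - U = (R U ξ - (U + ξ)) + ξ := by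
    intro U ξ; abel
  refine ⟨1 + M * δ + 2 * √k / δ, M + (2 * √k / δ ^ 2 + 1 / δ), by positivity, by positivity,
    fun U hU ξ hξ => ?_, fun U hU ξ hξ => ?_⟩
  · rcases lt_or_ge ‖ξ‖ δ with hlt | hge
    · calc ‖R U ξ - U‖ ≤ M * ‖ξ‖ ^ 2 + ‖ξ‖ := by
            rw [hsplit]
            exact (norm_add_le _ _).trans (by gcongr; exact h U hU ξ hξ hlt)
        _ ≤ M * (δ * ‖ξ‖) + ‖ξ‖ := by rw [sq]; gcongr
        _ ≤ M * (δ * ‖ξ‖) + ‖ξ‖ + 2 * √k / δ * ‖ξ‖ := le_add_of_nonneg_right (by positivity)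
        _ = _ := by ring
    · calc ‖R U ξ - U‖ ≤ 2 * √k := hfar U hU ξ hξ
        _ = 2 * √k / δ * δ := by field_simp
        _ ≤ 2 * √k / δ * ‖ξ‖ := by gcongr
        _ ≤ _ := by
          gcongr
          have : 0 ≤ M * δ := by positivity
          linarith
  · rcases lt_or_ge ‖ξ‖ δ with hlt | hge
    · refine (h U hU ξ hξ hlt).trans ?_
      gcongr
      exact le_add_of_nonneg_right (by positivity)
    · calc ‖R U ξ - (U + ξ)‖ ≤ 2 * √k + ‖ξ‖ := by
            rw [← sub_sub]
            exact (norm_sub_le _ _).trans (by gcongr; exact hfar U hU ξ hξ)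
        _ = 2 * √k / δ ^ 2 * (δ * δ) + 1 / δ * (δ * ‖ξ‖) := by field_simp
        _ ≤ 2 * √k / δ ^ 2 * (‖ξ‖ * ‖ξ‖) + 1 / δ * (‖ξ‖ * ‖ξ‖) := by gcongr
        _ = (2 * √k / δ ^ 2 + 1 / δ) * ‖ξ‖ ^ 2 := by ring
        _ ≤ _ := by
          exact mul_le_mul_of_nonneg_right (le_add_of_nonneg_left hM) (by positivity)

/-! ### Inequalities for finite probability vectors -/

theorem mul_log_sub_mul_log_le {x y : ℝ} (hx : 0 ≤ x) (hy : 0 < y) :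
    x * Real.log y - x * Real.log x ≤ y - x := by
  rcases hx.eq_or_lt with rfl | hx
  · simpa using hy.le
  · have h := Real.log_le_sub_one_of_pos (div_pos hy hx)
    rw [Real.log_div hy.ne' hx.ne'] at h
    calc _ = x * (Real.log y - Real.log x) := by ring
      _ ≤ x * (y / x - 1) := by gcongr
      _ = y - x := by field_simp

/-- The Gibbs inequality. -/
theorem sum_mul_log_le {ι : Type*} [Fintype ι] {x y : ι → ℝ} (hx : ∀ i, 0 ≤ x i)
    (hy : ∀ i, 0 < y i) (h : ∑ i, y i ≤ ∑ i, x i) :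
    ∑ i, x i * Real.log (y i) ≤ ∑ i, x i * Real.log (x i) := by
  have h1 := Finset.sum_le_sum fun i (_ : i ∈ Finset.univ) =>
    mul_log_sub_mul_log_le (hx i) (hy i)
  simp only [Finset.sum_sub_distrib] at h1
  linarith

theorem neg_log_card_le_sum_mul_log {ι : Type*} [Fintype ι] [Nonempty ι] {x : ι → ℝ}
    (hx : ∀ i, 0 ≤ x i) (hs : ∑ i, x i = 1) :
    -Real.log (Fintype.card ι) ≤ ∑ i, x i * Real.log (x i) := by
  have hc : (0 : ℝ) < Fintype.card ι := by exact_mod_cast Fintype.card_pos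
  have h := sum_mul_log_le (y := fun _ => (Fintype.card ι : ℝ)⁻¹) hx (fun _ => inv_pos.2 hc)
    (by rw [hs, Finset.sum_const, Finset.card_univ, nsmul_eq_mul, mul_inv_cancel₀ hc.ne'])
  rwa [← Finset.sum_mul, hs, one_mul, Real.log_inv] at h

theorem sum_mul_log_nonpos {ι : Type*} [Fintype ι] {x : ι → ℝ}
    (hx : ∀ i, 0 ≤ x i) (hs : ∑ i, x i = 1) : ∑ i, x i * Real.log (x i) ≤ 0 :=
  Finset.sum_nonpos fun i _ => mul_nonpos_of_nonneg_of_nonpos (hx i)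
    (Real.log_nonpos (hx i) (hs ▸ Finset.single_le_sum (fun j _ => hx j) (Finset.mem_univ i)))

/-- Hoeffding's lemma on a finite probability space. -/
theorem sum_mul_exp_le {ι : Type*} [Fintype ι] {p x : ι → ℝ} {b : ℝ} (hp : ∀ i, 0 ≤ p i)
    (hs : ∑ i, p i = 1) (hx : ∀ i, |x i| ≤ b) :
    ∑ i, p i * Real.exp (x i) ≤ Real.exp (∑ i, p i * x i + b ^ 2 / 2) := by
  classical
  let _ : MeasurableSpace ι := ⊤
  have hs' : ∑ i, ENNReal.ofReal (p i) = 1 := by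
    rw [← ENNReal.ofReal_sum_of_nonneg fun i _ => hp i, hs, ENNReal.ofReal_one]
  set ν := (PMF.ofFintype (fun i => ENNReal.ofReal (p i)) hs').toMeasure with hν
  have hint : ∀ f : ι → ℝ, ∫ i, f i ∂ν = ∑ i, p i * f i := by
    intro f
    rw [hν, PMF.integral_eq_sum]
    simp [ENNReal.toReal_ofReal (hp _)]
  have h := (ProbabilityTheory.hasSubgaussianMGF_of_mem_Icc (μ := ν) (X := x) (a := -b) (b := b)
    (measurable_of_finite x).aemeasurable
    (MeasureTheory.ae_of_all _ fun i => abs_le.1 (hx i))).mgf_le 1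
  rw [ProbabilityTheory.mgf, hint, hint] at h
  simp only [one_mul, Real.exp_sub, mul_div_assoc', ← Finset.sum_div] at h
  rw [div_le_iff₀ (Real.exp_pos _), ← Real.exp_add] at h
  refine h.trans (Real.exp_le_exp.2 (le_of_eq ?_))
  have : (((‖b - -b‖₊ / 2) ^ 2 : NNReal) : ℝ) = b ^ 2 := by
    push_cast
    rw [sub_neg_eq_add, ← two_mul, norm_mul, Real.norm_ofNat,
      mul_div_cancel_left₀ _ two_ne_zero, Real.norm_eq_abs, sq_abs]
  rw [this]
  ring

/-- A quadratic upper bound for the log-sum-exp function. -/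
theorem log_sum_exp_le {ι : Type*} [Fintype ι] [Nonempty ι] {a x : ι → ℝ} {b : ℝ}
    (hx : ∀ i, |x i| ≤ b) :
    Real.log (∑ i, Real.exp (a i + x i)) ≤ Real.log (∑ i, Real.exp (a i))
      + ∑ i, Real.exp (a i) / (∑ i', Real.exp (a i')) * x i + b ^ 2 / 2 := by
  have hS : 0 < ∑ i, Real.exp (a i) :=
    Finset.sum_pos (fun i _ => Real.exp_pos _) Finset.univ_nonempty
  have h := sum_mul_exp_le (p := fun i => Real.exp (a i) / ∑ i', Real.exp (a i'))
    (fun i => by positivity) (by rw [← Finset.sum_div, div_self hS.ne']) hx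
  have e : ∑ i, Real.exp (a i + x i)
      = (∑ i, Real.exp (a i)) * ∑ i, Real.exp (a i) / (∑ i', Real.exp (a i')) * Real.exp (x i) := by
    rw [Finset.mul_sum]
    refine Finset.sum_congr rfl fun i _ => ?_
    rw [Real.exp_add]
    field_simp
  have hpos : 0 < ∑ i, Real.exp (a i) / (∑ i', Real.exp (a i')) * Real.exp (x i) :=
    Finset.sum_pos (fun i _ => by positivity) Finset.univ_nonempty
  rw [e, Real.log_mul hS.ne' hpos.ne', add_assoc]
  gcongr
  exact (Real.log_le_iff_le_exp hpos).2 h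

theorem exp_sum_mul_log_le {ι : Type*} [Fintype ι] {w z : ι → ℝ} (hw : ∀ i, 0 ≤ w i)
    (hs : ∑ i, w i = 1) (hz : ∀ i, 0 < z i) :
    Real.exp (∑ i, w i * Real.log (z i)) ≤ ∑ i, w i * z i := by
  have hpos : 0 < ∑ i, w i * z i := by
    obtain ⟨i, -, hi⟩ : ∃ i ∈ Finset.univ, 0 < w i :=
      Finset.exists_lt_of_sum_lt (by simp [hs])
    exact Finset.sum_pos' (fun j _ => mul_nonneg (hw j) (hz j).le)
      ⟨i, Finset.mem_univ i, mul_pos hi (hz i)⟩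
  rw [← Real.le_log_iff_exp_le hpos]
  simpa using strictConcaveOn_log_Ioi.concaveOn.le_map_sum (t := Finset.univ) (w := w) (p := z)
    (fun i _ => hw i) hs (fun i _ => hz i)

theorem Data.geomMean_le_arithMean (P : Data m n d) (hP : P.Valid) {q : Fin m → Fin n → ℝ}
    (hq : ∀ l j, 0 < q l j) (j : Fin n) : P.geomMean q j ≤ P.arithMean q j :=
  exp_sum_mul_log_le (fun l => (hP.w_pos l).le) hP.w_sum fun l => hq l j

theorem Data.geomMean_pos (P : Data m n d) (q : Fin m → Fin n → ℝ) (j : Fin n) :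
    0 < P.geomMean q j := Real.exp_pos _

/-- The arithmetic-geometric mean inequality for square roots. -/
theorem Data.geomMean_le_sq (P : Data m n d) (hP : P.Valid) {q : Fin m → Fin n → ℝ}
    (hq : ∀ l j, 0 < q l j) (j : Fin n) :
    P.geomMean q j ≤ (∑ l, P.w l * √(q l j)) ^ 2 := by
  have h := exp_sum_mul_log_le (fun l => (hP.w_pos l).le) hP.w_sum
    fun l => Real.sqrt_pos.2 (hq l j)
  have e : P.geomMean q j = Real.exp (∑ l, P.w l * Real.log √(q l j)) ^ 2 := by
    rw [← Real.exp_nat_mul, Data.geomMean, Finset.mul_sum]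
    congr 1
    refine Finset.sum_congr rfl fun l _ => ?_
    rw [Real.log_sqrt (hq l j).le]
    push_cast
    ring
  rw [e]
  exact pow_le_pow_left₀ (Real.exp_pos _).le h 2

theorem Data.sum_arithMean (P : Data m n d) (hP : P.Valid) {q : Fin m → Fin n → ℝ}
    (hs : ∀ l, ∑ j, q l j = 1) : ∑ j, P.arithMean q j = 1 := by
  simp only [Data.arithMean]
  rw [Finset.sum_comm]
  simp [← Finset.mul_sum, hs, hP.w_sum]

theorem Data.sum_geomMean_le_one (P : Data m n d) (hP : P.Valid) {q : Fin m → Fin n → ℝ}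
    (hq : ∀ l j, 0 < q l j) (hs : ∀ l, ∑ j, q l j = 1) : ∑ j, P.geomMean q j ≤ 1 :=
  (Finset.sum_le_sum fun j _ => P.geomMean_le_arithMean hP hq j).trans
    (P.sum_arithMean hP hs).le

/-- The dispersion `∑ w^l ‖q^l - q̄‖₁` of the vectors `q^l` around their arithmetic mean. -/
def Data.dispersion (P : Data m n d) (q : Fin m → Fin n → ℝ) : ℝ :=
  ∑ l, P.w l * l1Norm (q l - P.arithMean q)

theorem Data.dispersion_nonneg (P : Data m n d) (hP : P.Valid) (q : Fin m → Fin n → ℝ) :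
    0 ≤ P.dispersion q :=
  Finset.sum_nonneg fun l _ => mul_nonneg (hP.w_pos l).le
    (Finset.sum_nonneg fun _ _ => abs_nonneg _)

/-- A strengthening of the arithmetic-geometric mean inequality: the gap between the means of
probability vectors dominates the square of their dispersion. The gap is at least the variance of
the square roots, and Cauchy-Schwarz compares this variance (a Hellinger distance) with the
dispersion. -/
theorem Data.dispersion_sq_le (P : Data m n d) (hP : P.Valid) {q : Fin m → Fin n → ℝ}
    (hq : ∀ l j, 0 < q l j) (hs : ∀ l, ∑ j, q l j = 1) :
    P.dispersion q ^ 2 ≤ 16 * (1 - ∑ j, P.geomMean q j) := by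
  set s : Fin m → Fin n → ℝ := fun l j => √(q l j) with hsdef
  have hsq : ∀ l j, s l j ^ 2 = q l j := fun l j => Real.sq_sqrt (hq l j).le
  set c : Fin n → ℝ := fun j => ∑ l, P.w l * s l j with hc
  have hc0 : ∀ j, 0 ≤ c j := fun j =>
    Finset.sum_nonneg fun l _ => mul_nonneg (hP.w_pos l).le (Real.sqrt_nonneg _)
  have hw := fun l => (hP.w_pos l).le
  have hwsum := hP.w_sum
  have hvar : ∀ j, ∑ l, P.w l * (s l j - c j) ^ 2 = P.arithMean q j - c j ^ 2 := by
    intro j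
    have : ∀ l, P.w l * (s l j - c j) ^ 2
        = P.w l * q l j - 2 * c j * (P.w l * s l j) + P.w l * c j ^ 2 := by
      intro l; rw [← hsq l j]; ring
    simp only [this, Finset.sum_add_distrib, Finset.sum_sub_distrib, ← Finset.mul_sum,
      ← Finset.sum_mul, hwsum, Data.arithMean]
    rw [show ∑ l, P.w l * s l j = c j from rfl]
    ring
  set V := ∑ j, ∑ l, P.w l * (s l j - c j) ^ 2 with hV
  have hVeq : V = 1 - ∑ j, c j ^ 2 := by
    rw [hV]; simp only [hvar, Finset.sum_sub_distrib, P.sum_arithMean hP hs]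
  have hV0 : 0 ≤ V := Finset.sum_nonneg fun j _ => Finset.sum_nonneg fun l _ =>
    mul_nonneg (hw l) (sq_nonneg _)
  have hVle : V ≤ 1 - ∑ j, P.geomMean q j := by
    rw [hVeq]
    exact sub_le_sub_left (Finset.sum_le_sum fun j _ => P.geomMean_le_sq hP hq j) _
  set W := ∑ j, ∑ l, P.w l * (s l j + c j) ^ 2 with hW
  have hWle : W ≤ 4 := by
    have h1 : W ≤ ∑ j, ∑ l, (2 * (P.w l * q l j) + 2 * (P.w l * c j ^ 2)) := by
      refine Finset.sum_le_sum fun j _ => Finset.sum_le_sum fun l _ => ?_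
      rw [← hsq l j]
      have := mul_nonneg (hw l) (sq_nonneg (s l j - c j))
      nlinarith
    have h2 : ∑ j, ∑ l, (2 * (P.w l * q l j) + 2 * (P.w l * c j ^ 2))
        = 2 * 1 + 2 * ∑ j, c j ^ 2 := by
      simp only [Finset.sum_add_distrib, ← Finset.mul_sum, ← Finset.sum_mul, hwsum, one_mul]
      rw [← P.sum_arithMean hP hs]
      rfl
    linarith
  set D := ∑ j, ∑ l, P.w l * |q l j - c j ^ 2| with hD
  have hDsq : D ^ 2 ≤ V * W := by
    have h1 : D = ∑ z : Fin n × Fin m, (√(P.w z.2) * |s z.2 z.1 - c z.1|)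
        * (√(P.w z.2) * |s z.2 z.1 + c z.1|) := by
      rw [hD, ← Finset.univ_product_univ, Finset.sum_product]
      refine Finset.sum_congr rfl fun j _ => Finset.sum_congr rfl fun l _ => ?_
      rw [mul_mul_mul_comm, Real.mul_self_sqrt (hw l), ← abs_mul, ← hsq l j]
      congr 2; ring
    rw [h1]
    refine (Finset.sum_mul_sq_le_sq_mul_sq _ _ _).trans (le_of_eq ?_)
    simp only [mul_pow, Real.sq_sqrt (hw _), sq_abs]
    rw [hV, hW, ← Finset.univ_product_univ, Finset.sum_product, Finset.sum_product]
  have hΔ : P.dispersion q ≤ 2 * D := by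
    have h1 : P.dispersion q = ∑ j, ∑ l, P.w l * |q l j - P.arithMean q j| := by
      simp only [Data.dispersion, l1Norm, Pi.sub_apply, Finset.mul_sum]
      exact Finset.sum_comm
    rw [h1, hD, Finset.mul_sum]
    refine Finset.sum_le_sum fun j _ => ?_
    have h2 : |c j ^ 2 - P.arithMean q j| ≤ ∑ l, P.w l * |q l j - c j ^ 2| := by
      have : c j ^ 2 - P.arithMean q j = ∑ l, P.w l * (c j ^ 2 - q l j) := by
        simp only [mul_sub, Finset.sum_sub_distrib, ← Finset.sum_mul, hwsum, one_mul]; rfl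
      rw [this]
      refine (Finset.abs_sum_le_sum_abs _ _).trans (le_of_eq ?_)
      exact Finset.sum_congr rfl fun l _ => by
        rw [abs_mul, abs_of_nonneg (hw l), abs_sub_comm]
    calc ∑ l, P.w l * |q l j - P.arithMean q j|
        ≤ ∑ l, P.w l * (|q l j - c j ^ 2| + |c j ^ 2 - P.arithMean q j|) :=
          Finset.sum_le_sum fun l _ => mul_le_mul_of_nonneg_left (abs_sub_le _ _ _) (hw l)
      _ = ∑ l, P.w l * |q l j - c j ^ 2| + |c j ^ 2 - P.arithMean q j| := by
          simp only [mul_add, Finset.sum_add_distrib, ← Finset.sum_mul, hwsum, one_mul]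
      _ ≤ _ := by linarith
  have hΔ0 := P.dispersion_nonneg hP q
  nlinarith [mul_le_mul_of_nonneg_left hWle hV0]

theorem Data.wmin_le (P : Data m n d) (l : Fin m) : P.wmin ≤ P.w l :=
  ciInf_le (Set.finite_range _).bddBelow l

theorem Data.Valid.nonempty {P : Data m n d} (hP : P.Valid) : Nonempty (Fin m) := by
  by_contra h
  rw [not_nonempty_iff] at h
  simpa using hP.w_sum

theorem Data.Valid.pos {P : Data m n d} (hP : P.Valid) : 0 < n := by
  obtain ⟨l⟩ := hP.nonempty
  rcases Nat.eq_zero_or_pos n with rfl | h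
  · simpa using hP.p_sum l
  · exact h

theorem Data.Valid.wmin_pos {P : Data m n d} (hP : P.Valid) : 0 < P.wmin := by
  have := hP.nonempty
  obtain ⟨l, hl⟩ := exists_eq_ciInf_of_finite (f := P.w)
  rw [Data.wmin, ← hl]
  exact hP.w_pos l

theorem Data.Valid.wmin_le_one {P : Data m n d} (hP : P.Valid) : P.wmin ≤ 1 := by
  obtain ⟨l⟩ := hP.nonempty
  rw [← hP.w_sum]
  exact (P.wmin_le l).trans (Finset.single_le_sum (fun l _ => (hP.w_pos l).le) (Finset.mem_univ l))

/-- A reverse inequality: the gap between the means is at most linear in the dispersion, because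
the geometric mean is at least the smallest entry. -/
theorem Data.wmin_mul_gap_le (P : Data m n d) (hP : P.Valid) {q : Fin m → Fin n → ℝ}
    (hq : ∀ l j, 0 < q l j) (hs : ∀ l, ∑ j, q l j = 1) :
    P.wmin * (1 - ∑ j, P.geomMean q j) ≤ P.dispersion q := by
  have := hP.nonempty
  have hw := fun l => (hP.w_pos l).le
  have h1 : P.dispersion q = ∑ j, ∑ l, P.w l * |q l j - P.arithMean q j| := by
    simp only [Data.dispersion, l1Norm, Pi.sub_apply, Finset.mul_sum]
    exact Finset.sum_comm
  rw [h1, ← P.sum_arithMean hP hs, ← Finset.sum_sub_distrib, Finset.mul_sum]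
  refine Finset.sum_le_sum fun j _ => ?_
  obtain ⟨l₀, hl₀⟩ := Finite.exists_min fun l => q l j
  have h2 : q l₀ j ≤ P.geomMean q j := by
    rw [Data.geomMean, ← Real.log_le_iff_le_exp (hq l₀ j)]
    calc Real.log (q l₀ j) = ∑ l, P.w l * Real.log (q l₀ j) := by
          rw [← Finset.sum_mul, hP.w_sum, one_mul]
      _ ≤ _ := Finset.sum_le_sum fun l _ => mul_le_mul_of_nonneg_left
          (Real.log_le_log (hq l₀ j) (hl₀ l)) (hw l)
  calc P.wmin * (P.arithMean q j - P.geomMean q j)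
      ≤ P.w l₀ * (P.arithMean q j - P.geomMean q j) :=
        mul_le_mul_of_nonneg_right (P.wmin_le l₀)
          (sub_nonneg.2 (P.geomMean_le_arithMean hP hq j))
    _ ≤ P.w l₀ * |q l₀ j - P.arithMean q j| := by
        refine mul_le_mul_of_nonneg_left ?_ (hw l₀)
        rw [abs_sub_comm]
        exact (sub_le_sub_left h2 _).trans (le_abs_self _)
    _ ≤ _ := Finset.single_le_sum (f := fun l => P.w l * |q l j - P.arithMean q j|)
        (fun l _ => mul_nonneg (hw l) (abs_nonneg _)) (Finset.mem_univ l₀)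

/-! ### The updates of the dual variables -/

section Updates

variable (P : Data m n d) (η : ℝ) (u v : Fin m → Fin n → ℝ) (U : Matrix (Fin d) (Fin k) ℝ)

theorem Data.colSum_pos (hn : 0 < n) (l : Fin m) (j : Fin n) : 0 < P.colSum η u v U l j := by
  have : Nonempty (Fin n) := ⟨⟨0, hn⟩⟩
  exact Finset.sum_pos (fun i _ => P.zeta_pos η u v U l i j) Finset.univ_nonempty

theorem Data.rowSum_zeta_pos (hn : 0 < n) (l : Fin m) (i : Fin n) :
    0 < ∑ j, P.zeta η u v U l i j := by
  have : Nonempty (Fin n) := ⟨⟨0, hn⟩⟩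
  exact Finset.sum_pos (fun j _ => P.zeta_pos η u v U l i j) Finset.univ_nonempty

theorem Data.rowSum_zeta_uUpdate (hP : P.Valid) (l : Fin m) (i : Fin n) :
    ∑ j, P.zeta η (P.uUpdate η u v U) v U l i j = P.p l i := by
  have hr := P.rowSum_zeta_pos η u v U hP.pos l i
  have h : ∀ j, P.zeta η (P.uUpdate η u v U) v U l i j
      = P.p l i / (∑ j, P.zeta η u v U l i j) * P.zeta η u v U l i j := by
    intro j
    rw [← Real.exp_log (div_pos (hP.p_pos l i) hr)]
    simp only [Data.zeta, Data.uUpdate, Matrix.of_apply, ← Real.exp_add]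
    congr 1; ring
  simp only [h, ← Finset.mul_sum]
  exact div_mul_cancel₀ _ hr.ne'

theorem Data.sum_zeta_uUpdate (hP : P.Valid) (l : Fin m) :
    ∑ i, ∑ j, P.zeta η (P.uUpdate η u v U) v U l i j = 1 := by
  simp only [P.rowSum_zeta_uUpdate η u v U hP, hP.p_sum]

theorem Data.sum_colSum_uUpdate (hP : P.Valid) (l : Fin m) :
    ∑ j, P.colSum η (P.uUpdate η u v U) v U l j = 1 := by
  simp only [Data.colSum]
  rw [Finset.sum_comm, P.sum_zeta_uUpdate η u v U hP]

theorem Data.zeta_vUpdate (hn : 0 < n) (l : Fin m) (i j : Fin n) :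
    P.zeta η u (P.vUpdate η u v U) U l i j
      = P.zeta η u v U l i j * (P.geomMean (P.colSum η u v U) j / P.colSum η u v U l j) := by
  have h : 0 < P.geomMean (P.colSum η u v U) j / P.colSum η u v U l j :=
    div_pos (P.geomMean_pos _ j) (P.colSum_pos η u v U hn l j)
  conv_rhs => rw [← Real.exp_log h]
  simp only [Data.zeta, Data.vUpdate, Matrix.of_apply, ← Real.exp_add]
  congr 1; ring

theorem Data.sum_zeta_vUpdate (hn : 0 < n) (l : Fin m) :
    ∑ i, ∑ j, P.zeta η u (P.vUpdate η u v U) U l i j = ∑ j, P.geomMean (P.colSum η u v U) j := by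
  refine Finset.sum_comm.trans (Finset.sum_congr rfl fun j _ => ?_)
  simp only [P.zeta_vUpdate η u v U hn, ← Finset.sum_mul]
  exact mul_div_cancel₀ _ (P.colSum_pos η u v U hn l j).ne'

theorem Data.vUpdate_eq (hn : 0 < n) (l : Fin m) (j : Fin n) :
    P.vUpdate η u v U l j = v l j + (∑ l', P.w l' * Real.log (P.colSum η u v U l' j))
      - Real.log (P.colSum η u v U l j) := by
  rw [Data.vUpdate, Real.log_div (P.geomMean_pos _ j).ne' (P.colSum_pos η u v U hn l j).ne',
    Data.geomMean, Real.log_exp]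
  ring

theorem Data.sum_w_vUpdate (hP : P.Valid) (hv : ∀ j, ∑ l, P.w l * v l j = 0) (j : Fin n) :
    ∑ l, P.w l * P.vUpdate η u v U l j = 0 := by
  simp only [P.vUpdate_eq η u v U hP.pos, mul_sub, mul_add, Finset.sum_sub_distrib,
    Finset.sum_add_distrib, ← Finset.sum_mul, hP.w_sum, hv]
  ring

/-- After the `u`-update the matrices `ζ` have total mass one, and only the linear part of `g`
is left. -/
theorem Data.g_uUpdate (hP : P.Valid) :
    P.g η (P.uUpdate η u v U) v U = -∑ l, P.w l * ∑ i, P.uUpdate η u v U l i * P.p l i := by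
  simp only [Data.g, P.sum_zeta_uUpdate η u v U hP, Real.log_one, zero_sub, mul_neg,
    Finset.sum_neg_distrib]

theorem Data.g_uUpdate_le (hP : P.Valid) : P.g η (P.uUpdate η u v U) v U ≤ P.g η u v U := by
  have hne : Nonempty (Fin n) := ⟨⟨0, hP.pos⟩⟩
  rw [P.g_uUpdate η u v U hP, ← Finset.sum_neg_distrib, Data.g]
  refine Finset.sum_le_sum fun l _ => ?_
  rw [← mul_neg]
  refine mul_le_mul_of_nonneg_left ?_ (hP.w_pos l).le
  have hr := fun i => P.rowSum_zeta_pos η u v U hP.pos l i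
  set r := fun i => ∑ j, P.zeta η u v U l i j with hrdef
  have hS : 0 < ∑ i, r i := Finset.sum_pos (fun i _ => hr i) Finset.univ_nonempty
  -- The decrease is the Kullback-Leibler divergence of `p` from the normalized row sums.
  have h := sum_mul_log_le (x := P.p l) (y := fun i => r i / ∑ i', r i')
    (fun i => (hP.p_pos l i).le) (fun i => div_pos (hr i) hS)
    (by rw [← Finset.sum_div, div_self hS.ne', hP.p_sum])
  have h1 : ∀ i, P.p l i * Real.log (r i / ∑ i', r i')
      = P.p l i * Real.log (r i) - P.p l i * Real.log (∑ i', r i') := by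
    intro i; rw [Real.log_div (hr i).ne' hS.ne', mul_sub]
  have h2 : ∀ i, P.uUpdate η u v U l i * P.p l i
      = u l i * P.p l i + P.p l i * Real.log (P.p l i) - P.p l i * Real.log (r i) := by
    intro i
    rw [Data.uUpdate, Real.log_div (hP.p_pos l i).ne' (hr i).ne']
    ring
  simp only [h1, Finset.sum_sub_distrib, ← Finset.sum_mul, hP.p_sum, one_mul] at h
  simp only [h2, Finset.sum_sub_distrib, Finset.sum_add_distrib]
  linarith

theorem Data.g_vUpdate_le (hP : P.Valid) (hs : ∀ l, ∑ j, P.colSum η u v U l j = 1) :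
    P.g η u (P.vUpdate η u v U) U
      ≤ P.g η u v U - P.dispersion (P.colSum η u v U) ^ 2 / 16 := by
  have hne : Nonempty (Fin n) := ⟨⟨0, hP.pos⟩⟩
  have h1 : ∀ l, ∑ i, ∑ j, P.zeta η u v U l i j = 1 := by
    exact fun l => Finset.sum_comm.trans (hs l)
  have hG : 0 < ∑ j, P.geomMean (P.colSum η u v U) j :=
    Finset.sum_pos (fun j _ => P.geomMean_pos _ j) Finset.univ_nonempty
  have h2 := P.dispersion_sq_le hP (P.colSum_pos η u v U hP.pos) hs
  have h3 := Real.log_le_sub_one_of_pos hG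
  simp only [Data.g, P.sum_zeta_vUpdate η u v U hP.pos, h1, Real.log_one, mul_sub,
    Finset.sum_sub_distrib, ← Finset.sum_mul, hP.w_sum]
  linarith

/-- Weak duality, tested on couplings whose second marginal is a point mass. -/
theorem Data.neg_cbar_div_le_g (hP : P.Valid) (hη : 0 < η) (hU : U ∈ stiefel d k)
    (hv : ∀ j, ∑ l, P.w l * v l j = 0) : -(P.cbar / η) ≤ P.g η u v U := by
  let j₀ : Fin n := ⟨0, hP.pos⟩
  have key : ∀ l, v l j₀ - P.cbar / η
      ≤ Real.log (∑ i, ∑ j, P.zeta η u v U l i j) - ∑ i, u l i * P.p l i := by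
    intro l
    have h1 : ∀ i, v l j₀ - P.cbar / η + u l i ≤ Real.log (∑ i, ∑ j, P.zeta η u v U l i j) := by
      intro i
      have h2 : P.zeta η u v U l i j₀ ≤ ∑ i, ∑ j, P.zeta η u v U l i j :=
        (Finset.single_le_sum (f := fun j => P.zeta η u v U l i j)
          (fun j _ => (P.zeta_pos η u v U l i j).le) (Finset.mem_univ j₀)).trans
        (Finset.single_le_sum (f := fun i => ∑ j, P.zeta η u v U l i j)
          (fun i _ => Finset.sum_nonneg fun j _ => (P.zeta_pos η u v U l i j).le)
          (Finset.mem_univ i))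
      refine le_trans ?_ (Real.log_le_log (P.zeta_pos η u v U l i j₀) h2)
      rw [Data.zeta, Matrix.of_apply, Real.log_exp, neg_div]
      have := div_le_div_of_nonneg_right (P.projCost_le_cbar hU l i j₀) hη.le
      linarith
    have h3 := Finset.sum_le_sum fun i (_ : i ∈ Finset.univ) =>
      mul_le_mul_of_nonneg_left (h1 i) (hP.p_pos l i).le
    simp only [mul_add, Finset.sum_add_distrib, ← Finset.sum_mul, hP.p_sum, one_mul] at h3
    simp only [mul_comm (u l _)]
    linarith
  calc -(P.cbar / η) = ∑ l, P.w l * (v l j₀ - P.cbar / η) := by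
        simp only [mul_sub, Finset.sum_sub_distrib, hv, ← Finset.sum_mul, hP.w_sum]
        ring
    _ ≤ _ := Finset.sum_le_sum fun l _ => mul_le_mul_of_nonneg_left (key l) (hP.w_pos l).le

theorem Data.log_colSum (hn : 0 < n) (l : Fin m) (j : Fin n) :
    Real.log (P.colSum η u v U l j)
      = v l j + Real.log (∑ i, Real.exp (-(P.projCost U l i j) / η + u l i)) := by
  have : Nonempty (Fin n) := ⟨⟨0, hn⟩⟩
  have hpos : 0 < ∑ i, Real.exp (-(P.projCost U l i j) / η + u l i) :=
    Finset.sum_pos (fun i _ => Real.exp_pos _) Finset.univ_nonempty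
  rw [← Real.log_exp (v l j), ← Real.log_mul (Real.exp_pos _).ne' hpos.ne', Finset.mul_sum]
  congr 1
  refine Finset.sum_congr rfl fun i _ => ?_
  rw [← Real.exp_add, Data.zeta, Matrix.of_apply]
  congr 1; ring

/-- Damping by the kernel `exp(-C / η)` changes the logarithm of a sum of exponentials by at most
`c̄ / η`. -/
theorem Data.log_sum_exp_bounds (hη : 0 < η) (hU : U ∈ stiefel d k) (l : Fin m)
    {I : Type*} [Fintype I] [Nonempty I] (a : I → ℝ) (e : I → Fin n × Fin n) :
    Real.log (∑ i, Real.exp (a i)) - P.cbar / η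
        ≤ Real.log (∑ i, Real.exp (-(P.projCost U l (e i).1 (e i).2) / η + a i)) ∧
      Real.log (∑ i, Real.exp (-(P.projCost U l (e i).1 (e i).2) / η + a i))
        ≤ Real.log (∑ i, Real.exp (a i)) := by
  have hpos : ∀ b : I → ℝ, 0 < ∑ i, Real.exp (b i) := fun b =>
    Finset.sum_pos (fun i _ => Real.exp_pos _) Finset.univ_nonempty
  have hC : ∀ i, P.projCost U l (e i).1 (e i).2 / η ≤ P.cbar / η := fun i =>
    div_le_div_of_nonneg_right (P.projCost_le_cbar hU l _ _) hη.le
  have hC0 : ∀ i, 0 ≤ P.projCost U l (e i).1 (e i).2 / η := fun i =>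
    div_nonneg (P.projCost_nonneg U l _ _) hη.le
  constructor
  · rw [← Real.log_exp (P.cbar / η), ← Real.log_div (hpos a).ne' (Real.exp_pos _).ne']
    refine Real.log_le_log (div_pos (hpos a) (Real.exp_pos _)) ?_
    rw [Finset.sum_div]
    refine Finset.sum_le_sum fun i _ => ?_
    rw [← Real.exp_sub, Real.exp_le_exp, neg_div]
    linarith [hC i]
  · refine Real.log_le_log (hpos _) (Finset.sum_le_sum fun i _ => Real.exp_le_exp.2 ?_)
    rw [neg_div]
    linarith [hC0 i]

/-- After a full round of updates of the dual variables the value of `g` is bounded independently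
of the starting point: `v` is determined up to additive constants and an error `c̄ / η`. -/
theorem Data.g_le_of_vUpdate (hP : P.Valid) (hη : 0 < η) (hU : U ∈ stiefel d k)
    (hv : ∀ j, ∑ l, P.w l * v l j = 0) (u' : Fin m → Fin n → ℝ) (V : Matrix (Fin d) (Fin k) ℝ) :
    P.g η (P.uUpdate η u' (P.vUpdate η u v U) V) (P.vUpdate η u v U) V
      ≤ 2 * Real.log n + P.cbar / η := by
  have hne : Nonempty (Fin n) := ⟨⟨0, hP.pos⟩⟩
  set v₁ := P.vUpdate η u v U with hv₁
  set S : Fin m → ℝ := fun l => Real.log (∑ i, Real.exp (u l i)) with hS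
  set M : Fin m → ℝ := fun l => (∑ l', P.w l' * S l') - S l + P.cbar / η with hM
  have hb := fun l j => P.log_sum_exp_bounds η U hη hU l (u l) fun i => (i, j)
  have hvM : ∀ l j, v₁ l j ≤ M l := by
    intro l j
    rw [hv₁, P.vUpdate_eq η u v U hP.pos]
    simp only [P.log_colSum η u v U hP.pos, mul_add, Finset.sum_add_distrib, hv]
    have h1 := (hb l j).1
    have h2 := Finset.sum_le_sum fun l (_ : l ∈ Finset.univ) =>
      mul_le_mul_of_nonneg_left (hb l j).2 (hP.w_pos l).le
    simp only [hM, hS]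
    linarith
  have hn0 : (0 : ℝ) < n := by exact_mod_cast hP.pos
  have hu : ∀ l i, -(P.uUpdate η u' v₁ V l i) ≤ -Real.log (P.p l i) + Real.log n + M l := by
    intro l i
    have hr := P.rowSum_zeta_pos η u' v₁ V hP.pos l i
    rw [Data.uUpdate, Real.log_div (hP.p_pos l i).ne' hr.ne']
    have h1 : Real.log (∑ j, P.zeta η u' v₁ V l i j) ≤ u' l i + (Real.log n + M l) := by
      rw [← Real.log_exp (M l), ← Real.log_exp (u' l i),
        ← Real.log_mul hn0.ne' (Real.exp_pos _).ne',
        ← Real.log_mul (Real.exp_pos _).ne' (mul_pos hn0 (Real.exp_pos _)).ne']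
      refine Real.log_le_log hr ?_
      calc ∑ j, P.zeta η u' v₁ V l i j
          ≤ ∑ j : Fin n, Real.exp (u' l i) * Real.exp (M l) := by
            refine Finset.sum_le_sum fun j _ => ?_
            rw [← Real.exp_add, Data.zeta, Matrix.of_apply, Real.exp_le_exp, neg_div]
            have := div_nonneg (P.projCost_nonneg V l i j) hη.le
            linarith [hvM l j]
        _ = _ := by
            rw [Finset.sum_const, Finset.card_univ, Fintype.card_fin, nsmul_eq_mul]
            ring
    linarith
  rw [P.g_uUpdate η u' v₁ V hP, ← Finset.sum_neg_distrib]
  calc ∑ l, -(P.w l * ∑ i, P.uUpdate η u' v₁ V l i * P.p l i)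
      ≤ ∑ l, P.w l * (2 * Real.log n + M l) := by
        refine Finset.sum_le_sum fun l _ => ?_
        rw [← mul_neg, ← Finset.sum_neg_distrib]
        refine mul_le_mul_of_nonneg_left ?_ (hP.w_pos l).le
        have h1 := Finset.sum_le_sum fun i (_ : i ∈ Finset.univ) =>
          mul_le_mul_of_nonneg_left (hu l i) (hP.p_pos l i).le
        simp only [mul_add, Finset.sum_add_distrib, ← Finset.sum_mul, hP.p_sum, one_mul, mul_neg,
          Finset.sum_neg_distrib] at h1
        have h2 := neg_log_card_le_sum_mul_log (fun i => (hP.p_pos l i).le) (hP.p_sum l)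
        rw [Fintype.card_fin] at h2
        simp only [mul_comm _ (P.p l _), Finset.sum_neg_distrib]
        linarith
    _ = 2 * Real.log n + P.cbar / η := by
        simp only [hM, mul_add, mul_sub, Finset.sum_add_distrib, Finset.sum_sub_distrib,
          ← Finset.sum_mul, hP.w_sum]
        ring

end Updates

/-! ### The gradient step on the Stiefel manifold -/

section GradientStep

variable (P : Data m n d) (η : ℝ) (u v : Fin m → Fin n → ℝ)

theorem Data.sum_piDual (hn : 0 < n) (U : Matrix (Fin d) (Fin k) ℝ) (l : Fin m) :
    ∑ i, ∑ j, P.piDual η u v U l i j = 1 := by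
  have : Nonempty (Fin n) := ⟨⟨0, hn⟩⟩
  have hS : 0 < ∑ i, ∑ j, P.zeta η u v U l i j :=
    Finset.sum_pos (fun i _ => P.rowSum_zeta_pos η u v U hn l i) Finset.univ_nonempty
  simp only [Data.piDual, Matrix.of_apply, ← Finset.sum_div]
  exact div_self hS.ne'

theorem Data.piDual_nonneg (U : Matrix (Fin d) (Fin k) ℝ) (l : Fin m) (i j : Fin n) :
    0 ≤ P.piDual η u v U l i j :=
  div_nonneg (P.zeta_pos η u v U l i j).le
    (Finset.sum_nonneg fun i _ => Finset.sum_nonneg fun j _ => (P.zeta_pos η u v U l i j).le)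

theorem Data.norm_euclideanGrad_g_le (hP : P.Valid) (hc : 0 ≤ P.cbar) (hη : 0 < η)
    {U : Matrix (Fin d) (Fin k) ℝ} (hU : U ∈ stiefel d k) :
    ‖euclideanGrad (fun W => P.g η u v W) U‖ ≤ 2 * P.cbar / η := by
  have h := P.norm_quadGrad_sub_le hP.w_pos hc (P.piDual η u v U) (fun _ => 0) hU
  simp only [P.quadGrad_zero, sub_zero, Matrix.zero_apply,
    abs_of_nonneg (P.piDual_nonneg η u v U _ _ _), P.sum_piDual η u v hP.pos, mul_one, hP.w_sum]
    at h
  rw [P.euclideanGrad_g hP.pos, norm_smul, norm_neg, norm_div, norm_one, Real.norm_of_nonneg hη.le]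
  calc 1 / η * ‖P.quadGrad (P.piDual η u v U) U‖ ≤ 1 / η * (2 * P.cbar) := by gcongr
    _ = _ := by ring

/-- The quadratic upper bound for `g(u, v, ·)` on the Stiefel manifold, from Hoeffding's lemma and
the concavity of `U ↦ -‖Uᵀ z‖²`. -/
theorem Data.g_le_quadratic (hP : P.Valid) (hη : 0 < η) {U V : Matrix (Fin d) (Fin k) ℝ}
    (hU : U ∈ stiefel d k) (hV : V ∈ stiefel d k) :
    P.g η u v V ≤ P.g η u v U + frob (euclideanGrad (fun W => P.g η u v W) U) (V - U)
      + 2 * P.cbar ^ 2 / η ^ 2 * ‖V - U‖ ^ 2 := by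
  have hne : Nonempty (Fin n) := ⟨⟨0, hP.pos⟩⟩
  have key : ∀ l, Real.log (∑ i, ∑ j, P.zeta η u v V l i j)
      ≤ Real.log (∑ i, ∑ j, P.zeta η u v U l i j)
        + -(1 / η) * ∑ i, ∑ j, P.piDual η u v U l i j * (2 * P.cross U (V - U) l i j)
        + 2 * P.cbar ^ 2 / η ^ 2 * ‖V - U‖ ^ 2 := by
    intro l
    have h := log_sum_exp_le (ι := Fin n × Fin n)
      (a := fun z => -(P.projCost U l z.1 z.2) / η + u l z.1 + v l z.2)
      (x := fun z => -(P.projCost V l z.1 z.2 - P.projCost U l z.1 z.2) / η)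
      (b := 2 * P.cbar * ‖V - U‖ / η) (fun z => by
        rw [abs_div, abs_neg, abs_of_pos hη]
        exact div_le_div_of_nonneg_right (P.abs_projCost_sub_le hU hV l z.1 z.2) hη.le)
    have e : ∀ z : Fin n × Fin n, -(P.projCost U l z.1 z.2) / η + u l z.1 + v l z.2
        + -(P.projCost V l z.1 z.2 - P.projCost U l z.1 z.2) / η
        = -(P.projCost V l z.1 z.2) / η + u l z.1 + v l z.2 := by
      intro z; ring
    simp only [e, Fintype.sum_prod_type] at h
    change Real.log (∑ i, ∑ j, P.zeta η u v V l i j) ≤ Real.log (∑ i, ∑ j, P.zeta η u v U l i j)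
      + ∑ i, ∑ j, P.piDual η u v U l i j * (-(P.projCost V l i j - P.projCost U l i j) / η) + _ at h
    refine h.trans ?_
    rw [Finset.mul_sum]
    refine add_le_add (add_le_add_right (Finset.sum_le_sum fun i _ => ?_) _) (le_of_eq (by ring))
    rw [Finset.mul_sum]
    refine Finset.sum_le_sum fun j _ => ?_
    have h1 := P.projCost_add U (V - U) l i j
    rw [add_sub_cancel] at h1
    have h2 := mul_nonneg (P.piDual_nonneg η u v U l i j)
      (div_nonneg (P.projCost_nonneg (V - U) l i j) hη.le)
    rw [h1]
    calc _ = -(1 / η) * (P.piDual η u v U l i j * (2 * P.cross U (V - U) l i j))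
          - P.piDual η u v U l i j * (P.projCost (V - U) l i j / η) := by ring
      _ ≤ _ := sub_le_self _ h2
  have h := Finset.sum_le_sum fun l (_ : l ∈ Finset.univ) =>
    mul_le_mul_of_nonneg_left (sub_le_sub_right (key l) (∑ i, u l i * P.p l i)) (hP.w_pos l).le
  rw [P.euclideanGrad_g hP.pos, frob_smul_left, P.frob_quadGrad, Data.g, Data.g]
  refine h.trans (le_of_eq ?_)
  have e : ∀ l, ∀ A B C D : ℝ, P.w l * (A + -(1 / η) * B + C - D)
      = P.w l * (A - D) + -(1 / η) * (P.w l * B) + P.w l * C := by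
    intros; ring
  simp only [e, Finset.sum_add_distrib]
  rw [← Finset.mul_sum, ← Finset.sum_mul, hP.w_sum, one_mul]

/-- One gradient step decreases `g` by half of the step size times the squared norm of the
Riemannian gradient. -/
theorem Data.g_retraction_le (hP : P.Valid) (hc : 0 ≤ P.cbar) (hη : 0 < η)
    {R : Matrix (Fin d) (Fin k) ℝ → Matrix (Fin d) (Fin k) ℝ → Matrix (Fin d) (Fin k) ℝ}
    {L₁ L₂ : ℝ} (hR : IsRetraction R) (hL : IsRetractionConst R L₁ L₂)
    {U : Matrix (Fin d) (Fin k) ℝ} (hU : U ∈ stiefel d k) {τ : ℝ} (hτ : 0 < τ)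
    (hτ' : τ * (4 * L₂ * P.cbar / η + (2 * P.cbar / η + 4 * P.cbar ^ 2 / η ^ 2) * L₁ ^ 2) ≤ 1) :
    P.g η u v (R U (-(τ • riemannianGrad (fun W => P.g η u v W) U)))
      ≤ P.g η u v U - τ / 2 * ‖riemannianGrad (fun W => P.g η u v W) U‖ ^ 2 := by
  set E := euclideanGrad (fun W => P.g η u v W) U with hE
  set r := riemannianGrad (fun W => P.g η u v W) U with hr
  have hrE : r = tangentProj U E := rfl
  have hrT : r ∈ tangentSpace U := tangentProj_mem hU _
  have hξT : -(τ • r) ∈ tangentSpace U := by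
    rw [← neg_smul]; exact smul_mem_tangentSpace _ hrT
  set ξ := -(τ • r) with hξ
  have hξn : ‖ξ‖ = τ * ‖r‖ := by rw [hξ, norm_neg, norm_smul, Real.norm_of_nonneg hτ.le]
  have h1 := P.g_le_quadratic η u v hP hη hU (hR.mapsTo U hU ξ hξT)
  rw [← hE] at h1
  have h2 : frob E (R U ξ - U) = frob E ξ + frob E (R U ξ - (U + ξ)) := by
    rw [← frob_add_right]; congr 1; abel
  have h3 : frob E ξ = -τ * ‖r‖ ^ 2 := by
    rw [hξ, ← neg_smul, frob_smul_right, ← frob_tangentProj E hrT, ← hrE, frob_self]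
  have h4 : frob E (R U ξ - (U + ξ)) ≤ 2 * P.cbar / η * (L₂ * (τ * ‖r‖) ^ 2) := by
    refine (le_abs_self _).trans ((abs_frob_le _ _).trans ?_)
    have := P.norm_euclideanGrad_g_le η u v hP hc hη hU
    have h5 := hL.bound₂ U hU ξ hξT
    rw [hξn] at h5
    gcongr
  have h5 : ‖R U ξ - U‖ ^ 2 ≤ (L₁ * (τ * ‖r‖)) ^ 2 := by
    have h5 := hL.bound₁ U hU ξ hξT
    rw [hξn] at h5
    gcongr
  have h6 : 2 * P.cbar ^ 2 / η ^ 2 * ‖R U ξ - U‖ ^ 2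
      ≤ 2 * P.cbar ^ 2 / η ^ 2 * (L₁ * (τ * ‖r‖)) ^ 2 := by gcongr
  have h7 := mul_le_mul_of_nonneg_left hτ' (by positivity : 0 ≤ τ / 2 * ‖r‖ ^ 2)
  have h8 : 0 ≤ τ ^ 2 * ‖r‖ ^ 2 * (P.cbar / η) * L₁ ^ 2 := by positivity
  rw [h2, h3] at h1
  calc _ ≤ _ := h1
    _ ≤ P.g η u v U + (-τ * ‖r‖ ^ 2 + 2 * P.cbar / η * (L₂ * (τ * ‖r‖) ^ 2))
        + 2 * P.cbar ^ 2 / η ^ 2 * (L₁ * (τ * ‖r‖)) ^ 2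
        + τ ^ 2 * ‖r‖ ^ 2 * (P.cbar / η) * L₁ ^ 2 := by linarith
    _ = P.g η u v U - τ * ‖r‖ ^ 2 + τ / 2 * ‖r‖ ^ 2 * (τ * (4 * L₂ * P.cbar / η
        + (2 * P.cbar / η + 4 * P.cbar ^ 2 / η ^ 2) * L₁ ^ 2)) := by ring
    _ ≤ _ := by linarith

end GradientStep

/-! ### The rounding procedure -/

section Rounding

variable {π : Matrix (Fin n) (Fin n) ℝ} {p q r : Fin n → ℝ}

theorem round_apply (hp : ∀ i, 0 < p i) (hrow : ∀ i, ∑ j, π i j = p i)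
    (hcol : ∀ j, ∑ i, π i j = q j) (i j : Fin n) :
    round π p r i j = π i j * min (r j / q j) 1
      + (p i - ∑ j', π i j' * min (r j' / q j') 1) * (r j - q j * min (r j / q j) 1)
        / l1Norm (fun i' => p i' - ∑ j', π i' j' * min (r j' / q j') 1) := by
  have h1 : (Matrix.diagonal fun i => min (p i / ∑ j, π i j) 1) = 1 := by
    rw [← Matrix.diagonal_one]
    congr 1
    funext i
    rw [hrow, div_self (hp i).ne', min_self]
  simp only [round, h1, Matrix.one_mul, Matrix.mul_diagonal, Matrix.of_apply, hcol,
    ← Finset.sum_mul]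

/-- If the rows of `π` already have the prescribed sums, then rounding moves `π` by at most the
distance of its vector of column sums to the prescribed one. -/
theorem round_spec (hπ : ∀ i j, 0 ≤ π i j) (hp : ∀ i, 0 < p i) (hps : ∑ i, p i = 1)
    (hq : ∀ j, 0 < q j) (hqs : ∑ j, q j = 1) (hr : ∀ j, 0 ≤ r j) (hrs : ∑ j, r j = 1)
    (hrow : ∀ i, ∑ j, π i j = p i) (hcol : ∀ j, ∑ i, π i j = q j) :
    (∀ i j, 0 ≤ round π p r i j) ∧ (∀ i, ∑ j, round π p r i j = p i) ∧
      (∀ j, ∑ i, round π p r i j = r j) ∧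
      ∑ i, ∑ j, |round π p r i j - π i j| ≤ l1Norm (q - r) := by
  set s : Fin n → ℝ := fun j => min (r j / q j) 1 with hs
  have hs0 : ∀ j, 0 ≤ s j := fun j => le_min (div_nonneg (hr j) (hq j).le) zero_le_one
  have hs1 : ∀ j, s j ≤ 1 := fun j => min_le_right _ _
  have hqmin : ∀ j, q j * s j = min (r j) (q j) := by
    intro j
    rw [hs, mul_min_of_nonneg _ _ (hq j).le, mul_div_cancel₀ _ (hq j).ne', mul_one]
  set a : Fin n → ℝ := fun i => p i - ∑ j, π i j * s j with ha
  set b : Fin n → ℝ := fun j => r j - q j * s j with hb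
  have ha0 : ∀ i, 0 ≤ a i := by
    intro i
    rw [ha, sub_nonneg, ← hrow i]
    exact Finset.sum_le_sum fun j _ => mul_le_of_le_one_right (hπ i j) (hs1 j)
  have hb0 : ∀ j, 0 ≤ b j := by
    intro j
    rw [hb, sub_nonneg, hqmin]
    exact min_le_left _ _
  set N := l1Norm a with hN
  have hNa : ∑ i, a i = N := Finset.sum_congr rfl fun i _ => (abs_of_nonneg (ha0 i)).symm
  have hNa' : N = 1 - ∑ j, q j * s j := by
    rw [← hNa]
    simp only [ha, Finset.sum_sub_distrib, hps]
    rw [Finset.sum_comm]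
    simp only [← Finset.sum_mul, hcol]
  have hNb : ∑ j, b j = N := by
    rw [hNa', hb, Finset.sum_sub_distrib, hrs]
  have hN0 : 0 ≤ N := hNa ▸ Finset.sum_nonneg fun i _ => ha0 i
  have hround : ∀ i j, round π p r i j = π i j * s j + a i * b j / N :=
    round_apply hp hrow hcol
  have hzero : ∀ c : Fin n → ℝ, (∀ i, 0 ≤ c i) → ∑ i, c i = N → ∀ i, c i * N / N = c i := by
    intro c hc hcN i
    rcases eq_or_ne N 0 with h0 | h0
    · rw [h0] at hcN ⊢
      have := (Finset.sum_eq_zero_iff_of_nonneg fun i _ => hc i).1 hcN i (Finset.mem_univ i)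
      rw [this]; simp
    · exact mul_div_cancel_right₀ _ h0
  have hrow' : ∀ i, ∑ j, a i * b j / N = a i := by
    intro i
    rw [← Finset.sum_div, ← Finset.mul_sum, hNb, hzero a ha0 hNa]
  have hcol' : ∀ j, ∑ i, a i * b j / N = b j := by
    intro j
    rw [← Finset.sum_div, ← Finset.sum_mul, hNa, mul_comm, hzero b hb0 hNb]
  have hpos : ∀ i j, 0 ≤ a i * b j / N := fun i j => div_nonneg (mul_nonneg (ha0 i) (hb0 j)) hN0
  refine ⟨fun i j => ?_, fun i => ?_, fun j => ?_, ?_⟩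
  · rw [hround]
    exact add_nonneg (mul_nonneg (hπ i j) (hs0 j)) (hpos i j)
  · simp only [hround, Finset.sum_add_distrib, hrow']
    exact add_sub_cancel _ _
  · simp only [hround, Finset.sum_add_distrib, hcol', ← Finset.sum_mul, hcol]
    exact add_sub_cancel _ _
  · calc ∑ i, ∑ j, |round π p r i j - π i j|
        ≤ ∑ i, ∑ j, ((π i j - π i j * s j) + a i * b j / N) := by
          refine Finset.sum_le_sum fun i _ => Finset.sum_le_sum fun j _ => ?_
          have h1 : 0 ≤ π i j - π i j * s j :=
            sub_nonneg.2 (mul_le_of_le_one_right (hπ i j) (hs1 j))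
          rw [hround, abs_le]
          constructor <;> linarith [hpos i j]
      _ = 2 * (1 - ∑ j, q j * s j) := by
          simp only [Finset.sum_add_distrib, hrow', hNa, Finset.sum_sub_distrib, hrow, hps]
          rw [hNa', Finset.sum_comm]
          simp only [← Finset.sum_mul, hcol]
          ring
      _ = l1Norm (q - r) := by
          have h1 : ∀ j, |(q - r) j| = q j + r j - 2 * (q j * s j) := by
            intro j
            rw [hqmin, Pi.sub_apply]
            rcases le_total (r j) (q j) with h | h
            · rw [min_eq_left h, abs_of_nonneg (sub_nonneg.2 h)]; ring
            · rw [min_eq_right h, abs_of_nonpos (sub_nonpos.2 h)]; ring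
          simp only [l1Norm, h1, Finset.sum_sub_distrib, Finset.sum_add_distrib, hqs, hrs,
            ← Finset.mul_sum]
          ring

end Rounding

/-! ### The primal problem -/

theorem Data.sum_coupling (P : Data m n d) (hP : P.Valid)
    {π : Fin m → Matrix (Fin n) (Fin n) ℝ} (hπ : π ∈ P.couplings) (l : Fin m) :
    ∑ i, ∑ j, π l i j = 1 := by
  simp only [hπ.2.1, hP.p_sum]

theorem Data.f_sub_f_le (P : Data m n d) (hP : P.Valid)
    (π π' : Fin m → Matrix (Fin n) (Fin n) ℝ) {U : Matrix (Fin d) (Fin k) ℝ}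
    (hU : U ∈ stiefel d k) :
    P.f π U - P.f π' U ≤ P.cbar * ∑ l, P.w l * ∑ i, ∑ j, |π l i j - π' l i j| := by
  rw [Data.f, Data.f, ← Finset.sum_sub_distrib, Finset.mul_sum]
  refine Finset.sum_le_sum fun l _ => ?_
  rw [← mul_sub, mul_left_comm]
  refine mul_le_mul_of_nonneg_left ?_ (hP.w_pos l).le
  simp only [← Finset.sum_sub_distrib, Finset.mul_sum]
  refine Finset.sum_le_sum fun i _ => Finset.sum_le_sum fun j _ => ?_
  rw [← sub_mul, mul_comm P.cbar]
  exact mul_le_mul (le_abs_self _) (P.projCost_le_cbar hU l i j) (P.projCost_nonneg U l i j)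
    (abs_nonneg _)

theorem Data.f_nonneg (P : Data m n d) (hP : P.Valid)
    {π : Fin m → Matrix (Fin n) (Fin n) ℝ} (hπ : ∀ l i j, 0 ≤ π l i j)
    (U : Matrix (Fin d) (Fin k) ℝ) : 0 ≤ P.f π U :=
  Finset.sum_nonneg fun l _ => mul_nonneg (hP.w_pos l).le (Finset.sum_nonneg fun i _ =>
    Finset.sum_nonneg fun j _ => mul_nonneg (hπ l i j) (P.projCost_nonneg U l i j))

theorem Data.f_le_cbar (P : Data m n d) (hP : P.Valid)
    {π : Fin m → Matrix (Fin n) (Fin n) ℝ} (hπ : π ∈ P.couplings) {U : Matrix (Fin d) (Fin k) ℝ}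
    (hU : U ∈ stiefel d k) : P.f π U ≤ P.cbar := by
  have h := P.f_sub_f_le hP π (fun _ => 0) hU
  have h0 : P.f (fun _ => 0) U = 0 := by simp [Data.f]
  simp only [h0, Matrix.zero_apply, sub_zero, abs_of_nonneg (hπ.1 _ _ _), P.sum_coupling hP hπ,
    mul_one, hP.w_sum] at h
  exact h

theorem Data.exists_isMinOn_f (P : Data m n d) (hP : P.Valid)
    {π : Fin m → Matrix (Fin n) (Fin n) ℝ} (hπ : π ∈ P.couplings) (U : Matrix (Fin d) (Fin k) ℝ) :
    ∃ πopt ∈ P.couplings, IsMinOn (fun π' => P.f π' U) P.couplings πopt := by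
  -- The couplings are handled as plain functions, with the product topology.
  let S : Set (Fin m → Fin n → Fin n → ℝ) := {π' | (fun l => Matrix.of (π' l)) ∈ P.couplings}
  have hcpt : IsCompact S := by
    refine Metric.isCompact_of_isClosed_isBounded ?_ ?_
    · have e : S = {π' | (∀ l i j, 0 ≤ π' l i j) ∧ (∀ l i, ∑ j, π' l i j = P.p l i) ∧
          ∀ l l' j, ∑ i, π' l i j = ∑ i, π' l' i j} := rfl
      rw [e]
      simp only [Set.ofPred_and, Set.ofPred_forall]
      refine IsClosed.inter ?_ (IsClosed.inter ?_ ?_)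
      · exact isClosed_iInter fun l => isClosed_iInter fun i => isClosed_iInter fun j =>
          isClosed_le (by fun_prop) (by fun_prop)
      · exact isClosed_iInter fun l => isClosed_iInter fun i =>
          isClosed_eq (by fun_prop) (by fun_prop)
      · exact isClosed_iInter fun l => isClosed_iInter fun l' => isClosed_iInter fun j =>
          isClosed_eq (by fun_prop) (by fun_prop)
    · refine isBounded_iff_forall_norm_le.2 ⟨1, fun π' hπ' => ?_⟩
      simp only [pi_norm_le_iff_of_nonneg zero_le_one]
      intro l i j
      have h1 : 0 ≤ π' l i j := hπ'.1 l i j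
      rw [Real.norm_of_nonneg h1, ← P.sum_coupling hP hπ' l]
      exact (Finset.single_le_sum (f := fun j => π' l i j) (fun j _ => hπ'.1 l i j)
        (Finset.mem_univ j)).trans
        (Finset.single_le_sum (f := fun i => ∑ j, π' l i j)
          (fun i _ => Finset.sum_nonneg fun j _ => hπ'.1 l i j) (Finset.mem_univ i))
  have hcont : Continuous fun π' : Fin m → Fin n → Fin n → ℝ =>
      ∑ l, P.w l * ∑ i, ∑ j, π' l i j * P.projCost U l i j := by fun_prop
  obtain ⟨π₀, hπ₀, hmin⟩ := hcpt.exists_isMinOn ⟨fun l i j => π l i j, hπ⟩ hcont.continuousOn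
  exact ⟨fun l => Matrix.of (π₀ l), hπ₀, fun π' hπ' => hmin (a := fun l i j => π' l i j) hπ'⟩

/-! ### Optimality of the returned point -/

section Output

variable (P : Data m n d) (η : ℝ) (u v : Fin m → Fin n → ℝ) (U : Matrix (Fin d) (Fin k) ℝ)

theorem Data.sum_w_mul_sum_mul_eq_zero {v : Fin m → Fin n → ℝ}
    (hv : ∀ j, ∑ l, P.w l * v l j = 0) (c : Fin n → ℝ) :
    ∑ l, P.w l * ∑ j, v l j * c j = 0 := by
  have e : ∀ l, P.w l * ∑ j, v l j * c j = ∑ j, P.w l * v l j * c j := fun l => by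
    rw [Finset.mul_sum]
    exact Finset.sum_congr rfl fun j _ => (mul_assoc _ _ _).symm
  simp only [e]
  rw [Finset.sum_comm]
  exact Finset.sum_eq_zero fun j _ => by rw [← Finset.sum_mul, hv, zero_mul]

/-- The primal gap of matrices `ζ(u, v, U)` of total mass one. They are optimal for the entropic
problem with their own marginals; the price is the difference of two entropies and a term which
measures by how much their second marginals `q^l` differ. -/
theorem Data.f_zeta_sub_f_le (hP : P.Valid) (hη : 0 < η)
    (hrow : ∀ l i, ∑ j, P.zeta η u v U l i j = P.p l i) (hv : ∀ j, ∑ l, P.w l * v l j = 0)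
    {π : Fin m → Matrix (Fin n) (Fin n) ℝ} (hπ : π ∈ P.couplings) :
    P.f (P.zeta η u v U) U - P.f π U
      ≤ η * ∑ l, P.w l * ∑ j, v l j * P.colSum η u v U l j + η * (2 * Real.log n) := by
  have hne : Nonempty (Fin n) := ⟨⟨0, hP.pos⟩⟩
  obtain ⟨l₀⟩ := hP.nonempty
  have hζlog : ∀ l i j, Real.log (P.zeta η u v U l i j)
      = -(P.projCost U l i j) / η + u l i + v l j := fun l i j => Real.log_exp _
  have hζ1 : ∀ l, ∑ i, ∑ j, P.zeta η u v U l i j = 1 := fun l => by simp only [hrow, hP.p_sum]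
  -- For matrices `x` with first marginal `p^l`, the sum of `x log ζ` splits into three parts.
  have hexp : ∀ l, ∀ x : Matrix (Fin n) (Fin n) ℝ, (∀ i, ∑ j, x i j = P.p l i) →
      ∑ i, ∑ j, x i j * Real.log (P.zeta η u v U l i j)
        = -(1 / η) * ∑ i, ∑ j, x i j * P.projCost U l i j + ∑ i, u l i * P.p l i
          + ∑ j, v l j * ∑ i, x i j := by
    intro l x hx
    have e : ∀ i j, x i j * Real.log (P.zeta η u v U l i j)
        = -(1 / η) * (x i j * P.projCost U l i j) + u l i * x i j + v l j * x i j := by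
      intro i j; rw [hζlog]; ring
    simp only [e, Finset.sum_add_distrib, ← Finset.mul_sum, hx]
    rw [Finset.sum_comm (f := fun i j => v l j * x i j)]
    simp only [← Finset.mul_sum]
  have key : ∀ l, (∑ i, ∑ j, P.zeta η u v U l i j * P.projCost U l i j)
      - ∑ i, ∑ j, π l i j * P.projCost U l i j
      ≤ η * (∑ j, v l j * P.colSum η u v U l j - ∑ j, v l j * ∑ i, π l₀ i j)
        + η * (2 * Real.log n) := by
    intro l
    have h1 := sum_mul_log_le (ι := Fin n × Fin n) (x := fun z => π l z.1 z.2)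
      (y := fun z => P.zeta η u v U l z.1 z.2) (fun z => hπ.1 l z.1 z.2)
      (fun z => P.zeta_pos η u v U l z.1 z.2)
      (by simp only [Fintype.sum_prod_type, hζ1, P.sum_coupling hP hπ, le_refl])
    have h2 := sum_mul_log_nonpos (ι := Fin n × Fin n) (x := fun z => π l z.1 z.2)
      (fun z => hπ.1 l z.1 z.2) (by simp only [Fintype.sum_prod_type, P.sum_coupling hP hπ])
    have h3 := neg_log_card_le_sum_mul_log (ι := Fin n × Fin n)
      (x := fun z => P.zeta η u v U l z.1 z.2) (fun z => (P.zeta_pos η u v U l z.1 z.2).le)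
      (by simp only [Fintype.sum_prod_type, hζ1])
    simp only [Fintype.sum_prod_type, Fintype.card_prod, Fintype.card_fin] at h1 h2 h3
    rw [hexp l _ (hπ.2.1 l)] at h1
    rw [hexp l _ (hrow l)] at h3
    have hn0 : (n : ℝ) ≠ 0 := by exact_mod_cast hP.pos.ne'
    rw [Nat.cast_mul, Real.log_mul hn0 hn0] at h3
    have h4 : ∑ j, v l j * ∑ i, π l i j = ∑ j, v l j * ∑ i, π l₀ i j :=
      Finset.sum_congr rfl fun j _ => by rw [hπ.2.2 l l₀ j]
    rw [h4] at h1
    change _ ≤ _ + ∑ j, v l j * P.colSum η u v U l j at h3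
    have h5 := mul_le_mul_of_nonneg_left (show
      (1 / η) * ((∑ i, ∑ j, P.zeta η u v U l i j * P.projCost U l i j)
        - ∑ i, ∑ j, π l i j * P.projCost U l i j) ≤
      (∑ j, v l j * P.colSum η u v U l j - ∑ j, v l j * ∑ i, π l₀ i j) + 2 * Real.log n by
        linarith) hη.le
    rw [← mul_assoc, mul_one_div_cancel hη.ne', one_mul] at h5
    linarith
  have h0 := P.sum_w_mul_sum_mul_eq_zero hv fun j => ∑ i, π l₀ i j
  have h := Finset.sum_le_sum fun l (_ : l ∈ Finset.univ) =>
    mul_le_mul_of_nonneg_left (key l) (hP.w_pos l).le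
  have e : ∀ l, ∀ A B C : ℝ, P.w l * (η * (A - B) + C)
      = η * (P.w l * A) - η * (P.w l * B) + P.w l * C := by
    intros; ring
  have e' : P.f (P.zeta η u v U) U - P.f π U = ∑ l, P.w l *
      ((∑ i, ∑ j, P.zeta η u v U l i j * P.projCost U l i j)
        - ∑ i, ∑ j, π l i j * P.projCost U l i j) := by
    rw [Data.f, Data.f, ← Finset.sum_sub_distrib]
    exact Finset.sum_congr rfl fun l _ => (mul_sub _ _ _).symm
  simp only [e, Finset.sum_sub_distrib, Finset.sum_add_distrib] at h
  rw [← e', ← Finset.sum_mul, hP.w_sum, one_mul, ← Finset.mul_sum, ← Finset.mul_sum, h0, mul_zero,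
    sub_zero] at h
  exact h

theorem sum_mul_sub_le {x q r : Fin n → ℝ} {a b : ℝ} (hx : ∀ j, |x j - a| ≤ b)
    (h : ∑ j, q j = ∑ j, r j) : ∑ j, x j * (q j - r j) ≤ b * l1Norm (q - r) := by
  have h1 : ∑ j, x j * (q j - r j) = ∑ j, (x j - a) * (q j - r j) := by
    simp only [sub_mul, Finset.sum_sub_distrib, ← Finset.mul_sum, h]
    ring
  rw [h1, l1Norm, Finset.mul_sum]
  refine Finset.sum_le_sum fun j _ => (le_abs_self _).trans ?_
  rw [abs_mul]
  exact mul_le_mul_of_nonneg_right (hx j) (abs_nonneg _)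

/-- When the column sums `q^l` nearly agree, the vectors `v^l` are bounded up to additive
constants, whatever their history is: `v^l` agrees with `log q^l` up to a constant and an error
`c̄ / η`, the geometric mean of the `q^l` is nearly uniform up to factors `exp(c̄ / η)`, and no
`log q^l` is positive. -/
theorem Data.sum_v_mul_colSum_le (hP : P.Valid) (hη : 0 < η) (hU : U ∈ stiefel d k)
    (hv : ∀ j, ∑ l, P.w l * v l j = 0) (hs : ∀ l, ∑ j, P.colSum η u v U l j = 1)
    (hG : 1 / 2 ≤ ∑ j, P.geomMean (P.colSum η u v U) j) :
    ∑ l, P.w l * ∑ j, v l j * P.colSum η u v U l j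
      ≤ ((Real.log (2 * n) + P.cbar / η) / (2 * P.wmin) + P.cbar / (2 * η))
        * P.dispersion (P.colSum η u v U) := by
  have hne : Nonempty (Fin n) := ⟨⟨0, hP.pos⟩⟩
  set q := P.colSum η u v U with hqdef
  have hq : ∀ l j, 0 < q l j := P.colSum_pos η u v U hP.pos
  set S : Fin m → ℝ := fun l => Real.log (∑ i, Real.exp (u l i)) with hS
  set β : Fin m → Fin n → ℝ := fun l j =>
    Real.log (∑ i, Real.exp (-(P.projCost U l i j) / η + u l i)) with hβ
  have hlog : ∀ l j, Real.log (q l j) = v l j + β l j := P.log_colSum η u v U hP.pos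
  have hβ1 : ∀ l j, S l - P.cbar / η ≤ β l j := fun l j =>
    (P.log_sum_exp_bounds η U hη hU l (u l) fun i => (i, j)).1
  have hβ2 : ∀ l j, β l j ≤ S l := fun l j =>
    (P.log_sum_exp_bounds η U hη hU l (u l) fun i => (i, j)).2
  have hlog0 : ∀ l j, Real.log (q l j) ≤ 0 := fun l j => Real.log_nonpos (hq l j).le
    (hs l ▸ Finset.single_le_sum (fun j _ => (hq l j).le) (Finset.mem_univ j))
  have hGβ : ∀ j, ∑ l, P.w l * Real.log (q l j) = ∑ l, P.w l * β l j := by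
    intro j
    simp only [hlog, mul_add, Finset.sum_add_distrib, hv, zero_add]
  have hn0 : (0 : ℝ) < n := by exact_mod_cast hP.pos
  set T := ∑ l, P.w l * S l with hT
  have hTlow : -Real.log (2 * n) ≤ T := by
    have h1 : ∑ j, P.geomMean q j ≤ n * Real.exp T := by
      calc ∑ j, P.geomMean q j ≤ ∑ _j : Fin n, Real.exp T := by
            refine Finset.sum_le_sum fun j _ => ?_
            rw [Data.geomMean, hGβ, Real.exp_le_exp]
            exact Finset.sum_le_sum fun l _ =>
              mul_le_mul_of_nonneg_left (hβ2 l j) (hP.w_pos l).le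
        _ = n * Real.exp T := by simp
    rw [← Real.log_inv, Real.log_le_iff_le_exp (by positivity), mul_inv, ← one_div,
      ← div_eq_mul_inv, div_le_iff₀ hn0, mul_comm]
    exact hG.trans h1
  set B := (Real.log (2 * n) + P.cbar / η) / P.wmin with hB
  have hlow : ∀ l j, -B ≤ Real.log (q l j) := by
    intro l j
    have h1 : -(Real.log (2 * n) + P.cbar / η) ≤ P.w l * Real.log (q l j) := by
      have h2 : ∑ l, P.w l * Real.log (q l j) ≤ P.w l * Real.log (q l j) := by
        have := Finset.single_le_sum (f := fun l => -(P.w l * Real.log (q l j)))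
          (fun l _ => neg_nonneg.2 (mul_nonpos_of_nonneg_of_nonpos (hP.w_pos l).le (hlog0 l j)))
          (Finset.mem_univ l)
        rw [Finset.sum_neg_distrib] at this
        exact neg_le_neg_iff.1 this
      have h3 : T - P.cbar / η ≤ ∑ l, P.w l * β l j := by
        have := Finset.sum_le_sum fun l (_ : l ∈ Finset.univ) =>
          mul_le_mul_of_nonneg_left (hβ1 l j) (hP.w_pos l).le
        simpa only [mul_sub, Finset.sum_sub_distrib, ← Finset.sum_mul, hP.w_sum, one_mul] using this
      rw [hGβ] at h2
      linarith
    have h2 : P.w l * Real.log (q l j) ≤ P.wmin * Real.log (q l j) :=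
      mul_le_mul_of_nonpos_right (P.wmin_le l) (hlog0 l j)
    rw [hB, ← neg_div, div_le_iff₀' hP.wmin_pos]
    exact h1.trans h2
  have hosc : ∀ l j, |v l j - (P.cbar / (2 * η) - S l - B / 2)| ≤ B / 2 + P.cbar / (2 * η) := by
    intro l j
    have h1 := hlow l j
    have h2 := hlog0 l j
    rw [hlog] at h1 h2
    have h3 := hβ1 l j
    have h4 := hβ2 l j
    have h5 : P.cbar / η = P.cbar / (2 * η) + P.cbar / (2 * η) := by field_simp; ring
    rw [abs_le]
    constructor <;> linarith
  have hA : ∑ j, P.arithMean q j = 1 := P.sum_arithMean hP hs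
  have hmain : ∑ l, P.w l * ∑ j, v l j * q l j
      = ∑ l, P.w l * ∑ j, v l j * (q l j - P.arithMean q j) := by
    have h0 := P.sum_w_mul_sum_mul_eq_zero hv (P.arithMean q)
    have e : ∀ l, ∑ j, v l j * (q l j - P.arithMean q j)
        = ∑ j, v l j * q l j - ∑ j, v l j * P.arithMean q j := by
      intro l
      rw [← Finset.sum_sub_distrib]
      exact Finset.sum_congr rfl fun j _ => mul_sub _ _ _
    rw [← sub_zero (∑ l, P.w l * ∑ j, v l j * q l j), ← h0, ← Finset.sum_sub_distrib]
    exact Finset.sum_congr rfl fun l _ => by rw [e, mul_sub]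
  have hBe : (Real.log (2 * n) + P.cbar / η) / (2 * P.wmin) = B / 2 := by
    rw [hB]; field_simp
  rw [hmain, hBe, Data.dispersion, Finset.mul_sum]
  refine Finset.sum_le_sum fun l _ => ?_
  rw [mul_left_comm]
  exact mul_le_mul_of_nonneg_left (sum_mul_sub_le (hosc l) ((hs l).trans hA.symm)) (hP.w_pos l).le

theorem Data.sum_abs_zeta_sub_piDual_le (hP : P.Valid)
    (hs : ∀ l, ∑ j, P.colSum η u v U l j = 1) (l : Fin m) :
    ∑ i, ∑ j, |P.zeta η u v U l i j - P.piDual η u (P.vUpdate η u v U) U l i j|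
      ≤ l1Norm (P.colSum η u v U l - P.arithMean (P.colSum η u v U))
        + 2 * (1 - ∑ j, P.geomMean (P.colSum η u v U) j) := by
  have hne : Nonempty (Fin n) := ⟨⟨0, hP.pos⟩⟩
  set q := P.colSum η u v U with hqdef
  have hq : ∀ l j, 0 < q l j := P.colSum_pos η u v U hP.pos
  set G := P.geomMean q with hGdef
  set A := P.arithMean q with hAdef
  set Q := ∑ j, G j with hQdef
  have hG0 : ∀ j, 0 < G j := P.geomMean_pos q
  have hQ0 : 0 < Q := Finset.sum_pos (fun j _ => hG0 j) Finset.univ_nonempty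
  have hQ1 : Q ≤ 1 := P.sum_geomMean_le_one hP hq hs
  have h1 : ∀ i j, |P.zeta η u v U l i j - P.piDual η u (P.vUpdate η u v U) U l i j|
      = P.zeta η u v U l i j * (|q l j - G j / Q| / q l j) := by
    intro i j
    have e : P.zeta η u v U l i j - P.piDual η u (P.vUpdate η u v U) U l i j
        = P.zeta η u v U l i j * ((q l j - G j / Q) / q l j) := by
      rw [Data.piDual, Matrix.of_apply, P.sum_zeta_vUpdate η u v U hP.pos,
        P.zeta_vUpdate η u v U hP.pos, sub_div, div_self (hq l j).ne']
      ring
    rw [e, abs_mul, abs_div, abs_of_pos (hq l j), abs_of_pos (P.zeta_pos η u v U l i j)]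
  simp only [h1]
  rw [Finset.sum_comm]
  simp only [← Finset.sum_mul]
  have h2 : ∀ j, (∑ i, P.zeta η u v U l i j) * (|q l j - G j / Q| / q l j)
      ≤ |q l j - A j| + (A j - G j) + (G j / Q - G j) := by
    intro j
    change q l j * _ ≤ _
    rw [mul_div_cancel₀ _ (hq l j).ne']
    have hAG : 0 ≤ A j - G j := sub_nonneg.2 (P.geomMean_le_arithMean hP hq j)
    have hGQ : 0 ≤ G j / Q - G j := by
      rw [sub_nonneg, le_div_iff₀ hQ0]
      exact mul_le_of_le_one_right (hG0 j).le hQ1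
    rw [abs_le]
    have := abs_le.1 (le_refl |q l j - A j|)
    constructor <;> linarith
  refine (Finset.sum_le_sum fun j _ => h2 j).trans (le_of_eq ?_)
  simp only [Finset.sum_add_distrib, Finset.sum_sub_distrib, ← Finset.sum_div]
  rw [P.sum_arithMean hP hs, div_self hQ0.ne', l1Norm]
  simp only [Pi.sub_apply]
  ring

end Output

theorem etaParam_pos (n : ℕ) {ε : ℝ} (hε : 0 < ε) : 0 < etaParam n ε := by
  have : 0 ≤ Real.log n := Real.log_natCast_nonneg n
  unfold etaParam
  positivity

theorem Iterate.sum_q {P : Data m n d} (hP : P.Valid) (s : Iterate m n d k) (ε : ℝ) (l : Fin m) :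
    ∑ j, s.q P ε l j = 1 :=
  P.sum_colSum_uUpdate _ _ _ _ hP l

theorem Iterate.output_spec {P : Data m n d} (hP : P.Valid) (s : Iterate m n d k) (ε : ℝ) :
    s.output P ε ∈ P.couplings ∧
      ∑ l, P.w l * ∑ i, ∑ j, |s.output P ε l i j - P.zeta (etaParam n ε) (s.uNext P ε) s.v s.U l i j|
        ≤ P.dispersion (s.q P ε) := by
  set η := etaParam n ε
  have hζ : ∀ l, P.piDual η (s.uNext P ε) s.v s.U l = P.zeta η (s.uNext P ε) s.v s.U l := by
    intro l
    ext i j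
    rw [Data.piDual, Matrix.of_apply, Iterate.uNext, P.sum_zeta_uUpdate _ _ _ _ hP, div_one]
  have hq : ∀ l j, 0 < s.q P ε l j := P.colSum_pos _ _ _ _ hP.pos
  have h := fun l => round_spec (π := P.zeta η (s.uNext P ε) s.v s.U l) (p := P.p l)
    (q := s.q P ε l) (r := P.arithMean (s.q P ε)) (fun i j => (P.zeta_pos _ _ _ _ l i j).le)
    (hP.p_pos l) (hP.p_sum l) (hq l) (s.sum_q hP ε l)
    (fun j => Finset.sum_nonneg fun l _ => mul_nonneg (hP.w_pos l).le (hq l j).le)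
    (P.sum_arithMean hP (s.sum_q hP ε)) (P.rowSum_zeta_uUpdate _ _ _ _ hP l) (fun j => rfl)
  have hout : ∀ l, s.output P ε l
      = round (P.zeta η (s.uNext P ε) s.v s.U l) (P.p l) (P.arithMean (s.q P ε)) := by
    intro l; rw [← hζ]; rfl
  simp only [← hout] at h
  refine ⟨⟨fun l => (h l).1, fun l => (h l).2.1, fun l l' j => ?_⟩,
    Finset.sum_le_sum fun l _ => mul_le_mul_of_nonneg_left (h l).2.2.2 (hP.w_pos l).le⟩
  rw [(h l).2.2.1, (h l').2.2.1]

/-- If the stopping test is met, the returned point is `ε`-stationary. -/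
theorem Iterate.Stops.isStationary {P : Data m n d} (hP : P.Valid) (hc : 0 < P.cbar) {ε : ℝ}
    (hε : 0 < ε) {s : Iterate m n d k} (hU : s.U ∈ stiefel d k)
    (hv : ∀ j, ∑ l, P.w l * s.v l j = 0) (htest : s.Stops P ε) :
    P.IsStationary ε (s.output P ε) s.U := by
  obtain ⟨hdisp, hgrad⟩ := htest
  have hη := etaParam_pos n hε
  have hηdef : etaParam n ε * (4 * Real.log n + 2) = ε := by
    have : 0 ≤ Real.log n := Real.log_natCast_nonneg n
    rw [etaParam, div_mul_cancel₀]
    positivity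
  set η := etaParam n ε with hη'
  set wm := P.wmin with hwm
  have hwm_pos : 0 < wm := hP.wmin_pos
  have hwm_le : wm ≤ 1 := hP.wmin_le_one
  obtain ⟨hmem, hround⟩ := s.output_spec hP ε
  set Δ := P.dispersion (s.q P ε) with hΔ
  set ζ := P.zeta η (s.uNext P ε) s.v s.U with hζ
  set out := s.output P ε with hout
  have hΔle : Δ ≤ wm * (ε / (12 * P.cbar)) := by
    refine le_trans hdisp ?_
    rw [mul_div_assoc]
    refine mul_le_mul_of_nonneg_right ?_ (by positivity)
    calc wm ^ (3 / 2 : ℝ) ≤ wm ^ (1 : ℝ) :=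
          Real.rpow_le_rpow_of_exponent_ge hwm_pos hwm_le (by norm_num)
      _ = wm := Real.rpow_one wm
  have hΔle1 : Δ ≤ ε / (12 * P.cbar) := hΔle.trans (mul_le_of_le_one_left (by positivity) hwm_le)
  have hq : ∀ l j, 0 < s.q P ε l j := P.colSum_pos _ _ _ _ hP.pos
  have hs : ∀ l, ∑ j, s.q P ε l j = 1 := s.sum_q hP ε
  have hgap : 1 - ∑ j, P.geomMean (s.q P ε) j ≤ ε / (12 * P.cbar) :=
    le_of_mul_le_mul_left ((P.wmin_mul_gap_le hP hq hs).trans hΔle) hwm_pos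
  refine ⟨hmem, hU, ?_, ?_⟩
  · set π' := P.piDual η (s.uNext P ε) (s.vNext P ε) s.U with hπ'
    have h1 : riemannianGrad (fun W => P.f out W) s.U
        = tangentProj s.U (P.quadGrad out s.U - P.quadGrad π' s.U)
          + tangentProj s.U (P.quadGrad π' s.U) := by
      rw [riemannianGrad, P.euclideanGrad_f, tangentProj_sub, sub_add_cancel]
    have h2 : ‖tangentProj s.U (P.quadGrad π' s.U)‖ = η * ‖s.gradNext P ε‖ := by
      rw [Iterate.gradNext, riemannianGrad, P.euclideanGrad_g hP.pos, tangentProj_smul, norm_smul,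
        norm_neg, norm_div, norm_one, Real.norm_of_nonneg hη.le, ← mul_assoc,
        mul_one_div_cancel hη.ne', one_mul]
    have h3 : ∑ l, P.w l * ∑ i, ∑ j, |out l i j - π' l i j| ≤ 4 * (ε / (12 * P.cbar)) := by
      calc ∑ l, P.w l * ∑ i, ∑ j, |out l i j - π' l i j|
          ≤ ∑ l, P.w l * (∑ i, ∑ j, |out l i j - ζ l i j|
              + (l1Norm (s.q P ε l - P.arithMean (s.q P ε))
                + 2 * (1 - ∑ j, P.geomMean (s.q P ε) j))) := by
            refine Finset.sum_le_sum fun l _ => mul_le_mul_of_nonneg_left ?_ (hP.w_pos l).le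
            refine le_trans ?_ (add_le_add_right
              (P.sum_abs_zeta_sub_piDual_le η (s.uNext P ε) s.v s.U hP hs l) _)
            simp only [← Finset.sum_add_distrib]
            exact Finset.sum_le_sum fun i _ => Finset.sum_le_sum fun j _ => abs_sub_le _ _ _
        _ = ∑ l, P.w l * ∑ i, ∑ j, |out l i j - ζ l i j|
              + (Δ + 2 * (1 - ∑ j, P.geomMean (s.q P ε) j)) := by
            simp only [mul_add, Finset.sum_add_distrib, ← Finset.sum_mul, hP.w_sum, one_mul]
            rfl
        _ ≤ _ := by linarith
    have h4 := P.norm_quadGrad_sub_le hP.w_pos hc.le out π' hU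
    rw [h1]
    refine (norm_add_le _ _).trans ?_
    rw [h2]
    have h5 := (norm_tangentProj_le hU (P.quadGrad out s.U - P.quadGrad π' s.U)).trans h4
    have h6 := mul_le_mul_of_nonneg_left h3 (by positivity : 0 ≤ 2 * P.cbar)
    have h7 : 2 * P.cbar * (4 * (ε / (12 * P.cbar))) = 2 / 3 * ε := by field_simp; norm_num
    linarith
  · obtain ⟨πopt, hopt, hmin⟩ := P.exists_isMinOn_f hP hmem s.U
    refine ⟨πopt, hopt, hmin, ?_⟩
    rcases le_or_gt P.cbar ε with hcε | hcε
    · have h1 := P.f_le_cbar hP hmem hU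
      have h2 := P.f_nonneg hP hopt.1 s.U
      linarith
    · have h1 := P.f_sub_f_le hP out ζ hU
      have h2 := P.f_zeta_sub_f_le η (s.uNext P ε) s.v s.U hP hη
        (P.rowSum_zeta_uUpdate _ _ _ _ hP) hv hopt
      have hsmall : ε / (12 * P.cbar) ≤ 1 / 12 := by
        rw [div_le_div_iff₀ (by positivity) (by norm_num)]
        linarith
      have h3 := P.sum_v_mul_colSum_le η (s.uNext P ε) s.v s.U hP hη hU hv hs
        (by change 1 / 2 ≤ ∑ j, P.geomMean (s.q P ε) j; linarith)
      change _ ≤ _ * Δ at h3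
      have hn1 : (0 : ℝ) < n := by exact_mod_cast hP.pos
      have hlogn : 0 ≤ Real.log n := Real.log_natCast_nonneg n
      have hlog2n : 0 ≤ Real.log (2 * n) := by
        rw [Real.log_mul two_ne_zero hn1.ne']
        have := Real.log_pos one_lt_two
        linarith
      have hηlog : η * Real.log (2 * n) ≤ ε / 2 := by
        rw [Real.log_mul two_ne_zero hn1.ne']
        have := Real.log_two_lt_d9
        have h : Real.log 2 + Real.log n ≤ (4 * Real.log n + 2) / 2 := by linarith
        have := mul_le_mul_of_nonneg_left h hη.le
        linarith
      have h4 : P.cbar * ∑ l, P.w l * ∑ i, ∑ j, |out l i j - ζ l i j| ≤ ε / 12 := by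
        calc _ ≤ P.cbar * (ε / (12 * P.cbar)) := by gcongr; exact hround.trans hΔle1
          _ = ε / 12 := by field_simp
      have hΔ0 : 0 ≤ Δ := P.dispersion_nonneg hP _
      have h5 : η * ∑ l, P.w l * ∑ j, s.v l j * P.colSum η (s.uNext P ε) s.v s.U l j
          ≤ ε / 48 + ε / 12 := by
        calc _ ≤ η * (((Real.log (2 * n) + P.cbar / η) / (2 * wm) + P.cbar / (2 * η)) * Δ) := by
              gcongr
          _ = (η * Real.log (2 * n) + P.cbar) / (2 * wm) * Δ + P.cbar / 2 * Δ := by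
              field_simp
          _ ≤ (ε / 2 + P.cbar) / (2 * wm) * (wm * (ε / (12 * P.cbar)))
              + P.cbar / 2 * (ε / (12 * P.cbar)) := by gcongr
          _ = ε / 48 * (ε / P.cbar) + ε / 12 := by field_simp; ring
          _ ≤ ε / 48 * 1 + ε / 12 := by
              gcongr
              exact (div_le_one hc).2 hcε.le
          _ = _ := by ring
      have h6 : η * (2 * Real.log n) ≤ ε / 2 := by linarith
      linarith

/-! ### Decrease of the potential and the number of iterations -/

/-- The potential of an iterate: the value of the dual objective after the `u`-update. -/
noncomputable def Iterate.potential (s : Iterate m n d k) (P : Data m n d) (ε : ℝ) : ℝ :=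
  P.g (etaParam n ε) (s.uNext P ε) s.v s.U

/-- The guaranteed decrease of the potential in an iteration in which the algorithm does not
stop. -/
noncomputable def Data.minDecrease (P : Data m n d) (ε L₁ L₂ : ℝ) : ℝ :=
  min (P.wmin ^ 3 * ε ^ 2 / (2304 * P.cbar ^ 2))
    (P.tauParam ε L₁ L₂ / 2 * (ε / (3 * etaParam n ε)) ^ 2)

section Iteration

variable {P : Data m n d} (hP : P.Valid) (hc : 0 < P.cbar) {ε : ℝ} (hε : 0 < ε)
  {R : Matrix (Fin d) (Fin k) ℝ → Matrix (Fin d) (Fin k) ℝ → Matrix (Fin d) (Fin k) ℝ}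
  {L₁ L₂ : ℝ} (hR : IsRetraction R) (hL : IsRetractionConst R L₁ L₂)
include hP hc hε

omit hP in
theorem Data.tauParam_pos (h₁ : 0 < L₁) (h₂ : 0 < L₂) : 0 < P.tauParam ε L₁ L₂ := by
  have := etaParam_pos n hε
  unfold Data.tauParam Data.rhoParam
  positivity

theorem Data.minDecrease_pos (h₁ : 0 < L₁) (h₂ : 0 < L₂) : 0 < P.minDecrease ε L₁ L₂ := by
  have h1 := etaParam_pos n hε
  have h2 := Data.tauParam_pos hc hε h₁ h₂
  have h3 := hP.wmin_pos
  exact lt_min (by positivity) (by positivity)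

include hR hL

theorem Iterate.potential_next_le {s : Iterate m n d k} (hU : s.U ∈ stiefel d k) :
    (s.next P R ε L₁ L₂).potential P ε ≤ s.potential P ε - P.dispersion (s.q P ε) ^ 2 / 16
      - P.tauParam ε L₁ L₂ / 2 * ‖s.gradNext P ε‖ ^ 2 := by
  have hη := etaParam_pos n hε
  have h1 := P.g_uUpdate_le (etaParam n ε) (s.uNext P ε) (s.vNext P ε)
    (s.next P R ε L₁ L₂).U hP
  have h2 := P.g_vUpdate_le (etaParam n ε) (s.uNext P ε) s.v s.U hP (s.sum_q hP ε)
  have h3 := P.g_retraction_le (etaParam n ε) (s.uNext P ε) (s.vNext P ε) hP hc.le hη hR hL hU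
    (Data.tauParam_pos hc hε hL.pos₁ hL.pos₂) (by
      have h₁ := hL.pos₁
      have h₂ := hL.pos₂
      rw [Data.tauParam, Data.rhoParam, one_div, inv_mul_cancel₀]
      positivity)
  change P.g _ (P.uUpdate _ (s.uNext P ε) (s.vNext P ε) (s.next P R ε L₁ L₂).U)
    (s.vNext P ε) (s.next P R ε L₁ L₂).U ≤ _
  refine h1.trans (h3.trans ?_)
  change P.g _ (s.uNext P ε) (s.vNext P ε) s.U - _ ≤ _
  exact sub_le_sub_right h2 _

theorem Iterate.potential_next_le_of_not_stops {s : Iterate m n d k} (hU : s.U ∈ stiefel d k)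
    (htest : ¬ s.Stops P ε) :
    (s.next P R ε L₁ L₂).potential P ε ≤ s.potential P ε - P.minDecrease ε L₁ L₂ := by
  have hη := etaParam_pos n hε
  have hτ := Data.tauParam_pos hc hε hL.pos₁ hL.pos₂
  have h := Iterate.potential_next_le hP hc hε hR hL hU
  have hw := hP.wmin_pos
  rw [Iterate.Stops, not_and_or, not_le, not_le] at htest
  rcases htest with htest | htest
  · have h1 : (P.wmin ^ (3 / 2 : ℝ) * ε / (12 * P.cbar)) ^ 2 ≤ P.dispersion (s.q P ε) ^ 2 :=
      pow_le_pow_left₀ (by positivity) htest.le 2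
    have h2 : (P.wmin ^ (3 / 2 : ℝ)) ^ 2 = P.wmin ^ 3 := by
      rw [← Real.rpow_natCast, ← Real.rpow_mul hw.le, ← Real.rpow_natCast]
      norm_num
    have h3 : (P.wmin ^ (3 / 2 : ℝ) * ε / (12 * P.cbar)) ^ 2 / 16
        = P.wmin ^ 3 * ε ^ 2 / (2304 * P.cbar ^ 2) := by
      rw [div_pow, mul_pow, h2, mul_pow, div_div]
      ring_nf
    have h4 : P.minDecrease ε L₁ L₂ ≤ _ := min_le_left _ _
    have h5 : 0 ≤ P.tauParam ε L₁ L₂ / 2 * ‖s.gradNext P ε‖ ^ 2 := by positivity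
    linarith
  · have h1 : ε / (3 * etaParam n ε) ≤ ‖s.gradNext P ε‖ := by
      rw [div_le_iff₀ (by positivity)]
      linarith
    have h2 : P.tauParam ε L₁ L₂ / 2 * (ε / (3 * etaParam n ε)) ^ 2
        ≤ P.tauParam ε L₁ L₂ / 2 * ‖s.gradNext P ε‖ ^ 2 := by gcongr
    have h4 : P.minDecrease ε L₁ L₂ ≤ _ := min_le_right _ _
    have h5 : 0 ≤ P.dispersion (s.q P ε) ^ 2 / 16 := by positivity
    linarith

omit hc hε hL in
theorem Data.iterate_invariants {s₀ : Iterate m n d k} (hU : s₀.U ∈ stiefel d k)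
    (hv : ∀ j, ∑ l, P.w l * s₀.v l j = 0) (t : ℕ) :
    (P.iterate R ε L₁ L₂ s₀ t).U ∈ stiefel d k ∧
      ∀ j, ∑ l, P.w l * (P.iterate R ε L₁ L₂ s₀ t).v l j = 0 := by
  induction t with
  | zero => exact ⟨hU, hv⟩
  | succ t ih =>
    refine ⟨hR.mapsTo _ ih.1 _ ?_, P.sum_w_vUpdate _ _ _ _ hP ih.2⟩
    rw [← neg_smul]
    exact smul_mem_tangentSpace _ (tangentProj_mem ih.1 _)

/-- From the second iterate on the potential lies in an interval of length
`2 log n + 2 c̄ / η`. -/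
theorem Data.sub_one_mul_minDecrease_le {s₀ : Iterate m n d k} (hU : s₀.U ∈ stiefel d k)
    (hv : ∀ j, ∑ l, P.w l * s₀.v l j = 0) {t : ℕ}
    (ht : ∀ t' < t, ¬ (P.iterate R ε L₁ L₂ s₀ t').Stops P ε) :
    ((t : ℝ) - 1) * P.minDecrease ε L₁ L₂
      ≤ 2 * Real.log n + 2 * P.cbar / etaParam n ε := by
  have hη := etaParam_pos n hε
  have hδ := Data.minDecrease_pos hP hc hε hL.pos₁ hL.pos₂
  have hinv := Data.iterate_invariants (ε := ε) (L₁ := L₁) (L₂ := L₂) hP hR hU hv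
  have hlogn : 0 ≤ Real.log n := Real.log_natCast_nonneg n
  rcases t with _ | t
  · rw [Nat.cast_zero, zero_sub, neg_one_mul]
    have : 0 ≤ 2 * Real.log n + 2 * P.cbar / etaParam n ε := by positivity
    linarith
  · have h1 : ∀ r ≤ t, (P.iterate R ε L₁ L₂ s₀ (r + 1)).potential P ε
        ≤ (P.iterate R ε L₁ L₂ s₀ 1).potential P ε - r * P.minDecrease ε L₁ L₂ := by
      intro r
      induction r with
      | zero => intro _; simp
      | succ r ih =>
        intro hr
        have h2 := ih (by omega)
        have h3 := Iterate.potential_next_le_of_not_stops hP hc hε hR hL (hinv (r + 1)).1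
          (ht (r + 1) (by omega))
        change (P.iterate R ε L₁ L₂ s₀ (r + 1 + 1)).potential P ε ≤ _ at h3
        push_cast
        linarith
    have h2 := h1 t le_rfl
    have h3 : -(P.cbar / etaParam n ε) ≤ (P.iterate R ε L₁ L₂ s₀ (t + 1)).potential P ε :=
      P.neg_cbar_div_le_g _ _ _ _ hP hη (hinv (t + 1)).1 (hinv (t + 1)).2
    have h4 : (P.iterate R ε L₁ L₂ s₀ 1).potential P ε ≤ 2 * Real.log n + P.cbar / etaParam n ε :=
      P.g_le_of_vUpdate _ _ _ _ hP hη hU hv _ _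
    have h5 : 2 * P.cbar / etaParam n ε = P.cbar / etaParam n ε + P.cbar / etaParam n ε := by ring
    push_cast
    linarith

theorem Data.exists_breaksAt {s₀ : Iterate m n d k} (hU : s₀.U ∈ stiefel d k)
    (hv : ∀ j, ∑ l, P.w l * s₀.v l j = 0) :
    ∃ T : ℕ, P.BreaksAt R ε L₁ L₂ s₀ T ∧ ((T : ℝ) - 1) * P.minDecrease ε L₁ L₂
      ≤ 2 * Real.log n + 2 * P.cbar / etaParam n ε := by
  classical
  have hδ := Data.minDecrease_pos hP hc hε hL.pos₁ hL.pos₂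
  have hex : ∃ T : ℕ, (P.iterate R ε L₁ L₂ s₀ T).Stops P ε := by
    by_contra! hno
    obtain ⟨N, hN⟩ :=
      exists_nat_gt ((2 * Real.log n + 2 * P.cbar / etaParam n ε) / P.minDecrease ε L₁ L₂)
    rw [div_lt_iff₀ hδ] at hN
    have h := Data.sub_one_mul_minDecrease_le hP hc hε hR hL hU hv (t := N + 1)
      fun t _ => hno t
    push_cast at h
    linarith
  refine ⟨Nat.find hex, ⟨Nat.find_spec hex, fun t ht => Nat.find_min hex ht⟩, ?_⟩
  exact Data.sub_one_mul_minDecrease_le hP hc hε hR hL hU hv fun t ht => Nat.find_min hex ht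

end Iteration

/-- The constant in the complexity bound. With `ι = κ⁻¹`, the product bounds the length of the
potential range times the reciprocal of the minimal decrease, and the last term absorbs the two
iterations that are not covered by that count. -/
noncomputable def complexityConst (κ : ℝ) : ℝ :=
  (16 + 2 * κ⁻¹) * (2304 * κ⁻¹ ^ 2 + 72 + 54 * κ⁻¹) * κ⁻¹ ^ 2 + 4 * κ⁻¹ ^ 7

theorem Data.iterations_le {P : Data m n d} (hP : P.Valid) (hc : 0 < P.cbar) {ε : ℝ} (hε : 0 < ε)
    {L₁ L₂ : ℝ} (h₁ : 0 < L₁) (h₂ : 0 < L₂) {T κ : ℝ}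
    (hT : (T - 1) * P.minDecrease ε L₁ L₂ ≤ 2 * Real.log n + 2 * P.cbar / etaParam n ε)
    (hκ : 0 < κ) (hn : 2 ≤ n) (hκL : κ ≤ L₁) (hκc : κ ≤ P.cbar) (hκε : κ * ε ≤ P.cbar)
    (hκL₂ : κ * (L₂ * ε) ≤ L₁ ^ 2 * P.cbar) :
    T + 1 ≤ complexityConst κ *
      (L₁ ^ 2 * P.cbar ^ 5 * Real.log n / (P.wmin ^ 3 * ε ^ 3)) := by
  have hδ := Data.minDecrease_pos hP hc hε h₁ h₂
  have hw0 := hP.wmin_pos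
  have hw1 := hP.wmin_le_one
  have hη := etaParam_pos n hε
  have hlog : 1 / 2 ≤ Real.log n := by
    have h1 := Real.log_le_log two_pos (show (2 : ℝ) ≤ n by exact_mod_cast hn)
    have := Real.log_two_gt_d9
    linarith
  have hdef : P.minDecrease ε L₁ L₂ = min (P.wmin ^ 3 * ε ^ 2 / (2304 * P.cbar ^ 2))
      (1 / (4 * L₂ * P.cbar / etaParam n ε + (2 * P.cbar / etaParam n ε
        + 4 * P.cbar ^ 2 / etaParam n ε ^ 2) * L₁ ^ 2) / 2 * (ε / (3 * etaParam n ε)) ^ 2) := rfl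
  have hηle : etaParam n ε ≤ ε / 2 := by
    rw [etaParam]
    gcongr
    linarith
  have hrange : 2 * P.cbar / etaParam n ε
      = 8 * Real.log n * (P.cbar / ε) + 4 * (P.cbar / ε) := by
    have : 4 * Real.log n + 2 ≠ 0 := by positivity
    rw [etaParam]
    field_simp
    ring
  set η := etaParam n ε
  set c := P.cbar
  set wm := P.wmin
  set lg := Real.log n
  set ι := κ⁻¹ with hι
  have hι0 : 0 < ι := inv_pos.2 hκ
  have hle : ∀ {x y : ℝ}, κ * x ≤ y → x ≤ ι * y := by
    intro x y h
    rw [hι, ← div_eq_inv_mul, le_div_iff₀ hκ, mul_comm]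
    exact h
  have hL1 : 1 ≤ ι * L₁ := hle (by simpa using hκL)
  have hc1 : 1 ≤ ι * c := hle (by simpa using hκc)
  have hε1 : ε ≤ ι * c := hle hκε
  have hL2 : L₂ * ε ≤ ι * (L₁ ^ 2 * c) := hle hκL₂
  have hw3 : wm ^ 3 ≤ 1 := pow_le_one₀ hw0.le hw1
  set C := 2304 * ι ^ 2 + 72 + 54 * ι with hC
  -- The reciprocal of the minimal decrease.
  set B := C * (L₁ ^ 2 * c ^ 2 / (wm ^ 3 * ε ^ 2)) with hB
  have hB0 : 0 < B := by positivity
  have hδB : 1 ≤ B * P.minDecrease ε L₁ L₂ := by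
    have hδB' : 1 / B ≤ P.minDecrease ε L₁ L₂ := by
      rw [hdef]
      refine le_min ?_ ?_
      · have h1 : 2304 * c ^ 2 / (wm ^ 3 * ε ^ 2) ≤ B := by
          calc 2304 * c ^ 2 / (wm ^ 3 * ε ^ 2)
              = 2304 * 1 ^ 2 * (c ^ 2 / (wm ^ 3 * ε ^ 2)) := by ring
            _ ≤ 2304 * (ι * L₁) ^ 2 * (c ^ 2 / (wm ^ 3 * ε ^ 2)) := by gcongr
            _ = 2304 * ι ^ 2 * (L₁ ^ 2 * c ^ 2 / (wm ^ 3 * ε ^ 2)) := by ring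
            _ ≤ B := by
              rw [hB]
              refine mul_le_mul_of_nonneg_right ?_ (by positivity)
              rw [hC, add_assoc]
              exact le_add_of_nonneg_right (by positivity)
        rw [← one_div_div (2304 * c ^ 2)]
        exact one_div_le_one_div_of_le (by positivity) h1
      · have h1 : 18 * (4 * (L₂ * η) * c + 2 * c * η * L₁ ^ 2 + 4 * c ^ 2 * L₁ ^ 2) / ε ^ 2
            ≤ B := by
          have e1 : L₂ * η ≤ ι * (L₁ ^ 2 * c) / 2 := by
            calc L₂ * η ≤ L₂ * (ε / 2) := by gcongr
              _ = L₂ * ε / 2 := by ring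
              _ ≤ _ := by gcongr
          have e2 : η ≤ ι * c / 2 := hηle.trans (by gcongr)
          calc 18 * (4 * (L₂ * η) * c + 2 * c * η * L₁ ^ 2 + 4 * c ^ 2 * L₁ ^ 2) / ε ^ 2
              ≤ 18 * (4 * (ι * (L₁ ^ 2 * c) / 2) * c + 2 * c * (ι * c / 2) * L₁ ^ 2
                + 4 * c ^ 2 * L₁ ^ 2) / ε ^ 2 := by gcongr
            _ = (72 + 54 * ι) * (L₁ ^ 2 * c ^ 2 / (1 * ε ^ 2)) := by ring
            _ ≤ (72 + 54 * ι) * (L₁ ^ 2 * c ^ 2 / (wm ^ 3 * ε ^ 2)) := by gcongr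
            _ ≤ B := by
              rw [hB]
              refine mul_le_mul_of_nonneg_right ?_ (by positivity)
              rw [hC, add_assoc]
              exact le_add_of_nonneg_left (by positivity)
        refine (one_div_le_one_div_of_le (by positivity) h1).trans (le_of_eq ?_)
        field_simp
        ring
    rwa [div_le_iff₀ hB0, mul_comm] at hδB'
  have hrange' : 2 * lg + 2 * c / η ≤ (16 + 2 * ι) * (lg * (c / ε)) := by
    have e1 : 1 ≤ ι * (c / ε) := by
      rw [← mul_div_assoc, le_div_iff₀ hε, one_mul]; exact hε1
    have e2 : 2 * lg * 1 ≤ 2 * lg * (ι * (c / ε)) := by gcongr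
    have e3 : 4 * (c / ε) ≤ 8 * lg * (c / ε) := by gcongr; linarith
    rw [hrange]
    linarith
  have hT1 : T - 1 ≤ B * (2 * lg + 2 * c / η) := by
    have hr0 : 0 ≤ 2 * lg + 2 * c / η := by positivity
    rcases le_or_gt T 1 with h | h
    · exact (sub_nonpos.2 h).trans (by positivity)
    · calc T - 1 = (T - 1) * 1 := (mul_one _).symm
        _ ≤ (T - 1) * (B * P.minDecrease ε L₁ L₂) :=
          mul_le_mul_of_nonneg_left hδB (sub_nonneg.2 h.le)
        _ = B * ((T - 1) * P.minDecrease ε L₁ L₂) := by ring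
        _ ≤ _ := by gcongr
  set Z := L₁ ^ 2 * c ^ 5 * lg / (wm ^ 3 * ε ^ 3) with hZ
  have hmain : B * (2 * lg + 2 * c / η) ≤ (16 + 2 * ι) * C * ι ^ 2 * Z := by
    calc B * (2 * lg + 2 * c / η) ≤ B * ((16 + 2 * ι) * (lg * (c / ε))) := by gcongr
      _ = (16 + 2 * ι) * C * (L₁ ^ 2 * c ^ 3 * lg / (wm ^ 3 * ε ^ 3)) * 1 ^ 2 := by
        rw [hB]; field_simp
      _ ≤ (16 + 2 * ι) * C * (L₁ ^ 2 * c ^ 3 * lg / (wm ^ 3 * ε ^ 3)) * (ι * c) ^ 2 := by gcongr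
      _ = _ := by rw [hZ]; ring
  have htwo : 2 ≤ 4 * ι ^ 7 * Z := by
    calc (2 : ℝ) ≤ 4 * lg * (1 ^ 2 * 1 ^ 2 * 1 ^ 3 / 1) := by linarith
      _ ≤ 4 * lg * ((ι * L₁) ^ 2 * (ι * c) ^ 2 * (ι * c / ε) ^ 3 / wm ^ 3) := by
        gcongr
        rwa [le_div_iff₀ hε, one_mul]
      _ = 4 * ι ^ 7 * Z := by rw [hZ]; field_simp
  have : complexityConst κ * Z = (16 + 2 * ι) * C * ι ^ 2 * Z + 4 * ι ^ 7 * Z := by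
    rw [complexityConst, ← hι, hC]; ring
  linarith

end RPRWB

theorem mainTheorem1 :
    (∀ (d k : ℕ)
        (R : Matrix (Fin d) (Fin k) ℝ → Matrix (Fin d) (Fin k) ℝ → Matrix (Fin d) (Fin k) ℝ),
        RPRWB.IsRetraction R → ∃ L₁ L₂ : ℝ, RPRWB.IsRetractionConst R L₁ L₂) ∧
    ∃ K : ℝ → ℝ, ∀ (m n d k : ℕ) (P : RPRWB.Data m n d), P.Valid → 0 < P.cbar →
      ∀ (R : Matrix (Fin d) (Fin k) ℝ → Matrix (Fin d) (Fin k) ℝ → Matrix (Fin d) (Fin k) ℝ)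
        (L₁ L₂ : ℝ), RPRWB.IsRetraction R → RPRWB.IsRetractionConst R L₁ L₂ →
      ∀ ε : ℝ, 0 < ε →
      ∀ s₀ : RPRWB.Iterate m n d k, s₀.U ∈ RPRWB.stiefel d k →
        (∀ j, ∑ l, P.w l * s₀.v l j = 0) →
      ∃ T : ℕ, P.BreaksAt R ε L₁ L₂ s₀ T ∧
        P.IsStationary ε ((P.iterate R ε L₁ L₂ s₀ T).output P ε) (P.iterate R ε L₁ L₂ s₀ T).U ∧
        ∀ κ : ℝ, 0 < κ → 2 ≤ n → κ ≤ L₁ → κ ≤ P.cbar → κ * ε ≤ P.cbar →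
          κ * (L₂ * ε) ≤ L₁ ^ 2 * P.cbar →
          (T + 1 : ℝ) ≤ K κ * (L₁ ^ 2 * P.cbar ^ 5 * Real.log n / (P.wmin ^ 3 * ε ^ 3)) := by
  refine ⟨fun d k R hR => hR.exists_const, RPRWB.complexityConst, ?_⟩
  intro m n d k P hP hc R L₁ L₂ hR hL ε hε s₀ hU hv
  obtain ⟨T, hbreak, hT⟩ := RPRWB.Data.exists_breaksAt hP hc hε hR hL hU hv
  have hinv := RPRWB.Data.iterate_invariants (ε := ε) (L₁ := L₁) (L₂ := L₂) hP hR hU hv T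
  refine ⟨T, hbreak, hbreak.1.isStationary hP hc hε hinv.1 hinv.2, ?_⟩
  intro κ hκ hn hκL hκc hκε hκL₂
  exact RPRWB.Data.iterations_le hP hc hε hL.pos₁ hL.pos₂ hT hκ hn hκL hκc hκε hκL₂
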